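/- A hypergraph $G$ has a finite vertex set $V(G)$ and a set $E(G)$ of edges, which are subsets of $V(G)$; it is $k$-uniform if every edge has exactly $k$ vertices. A path of length $l$ is a sequence $u_1,e_1,u_2,\dots,e_l,u_{l+1}$ of distinct vertices and distinct edges with $u_i,u_{i+1}\in e_i$ for all $i$; a cycle is such a sequence $u_1,e_1,\dots,u_l,e_l,u_1$ with $l\ge 2$, distinct vertices $u_1,\dots,u_l$ and distinct edges. A supertree is a connected hypergraph without cycles. The diameter is the largest distance between two vertices, the distance being the length of a shortest path. Let $\mathbb S(m,d,k)$ be the class of $k$-uniform supertrees with $m$ edges and diameter $d$, considered up to isomorphism. The signless Laplacian tensor $\mathcal Q(G)=\mathcal D(G)+\mathcal A(G)$ of a $k$-uniform hypergraph $G$ is the tensor of order $k$, indexed by $V(G)$, where $\mathcal D(G)$ is diagonal with the vertex degrees as diagonal entries, and $\mathcal A(G)$ has the entry $\frac1{(k-1)!}$ at $(i_1,\dots,i_k)$ if $\{i_1,\dots,i_k\}\in E(G)$, and $0$ otherwise. Let $q(G)$ be its spectral radius, that is, the largest $|\lambda|$ over all $\lambda\in\mathbb C$ for which there is a nonzero complex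 vector $x$ with $$\sum_{i_2,\dots,i_k}\mathcal Q(G)_{i i_2\cdots i_k}\,x_{i_2}\cdots x_{i_k}=\lambda x_i^{k-1}\qquad\text{for all } i\in V(G).$$ Let $P$ be the $k$-uniform loose path $v_1,e_1,v_2,e_2,v_3,e_3,v_4$ of length $3$, in which $e_1\cap e_2=\{v_2\}$, $e_2\cap e_3=\{v_3\}$, $e_1\cap e_3=\emptyset$, $v_1\in e_1\setminus\{v_2\}$ and $v_4\in e_3\setminus\{v_3\}$. Attaching an edge at a vertex $v$ means adding $k-1$ new vertices and the edge formed by them and $v$. Let * $S_1(m,3,k)$ be obtained from $P$ by attaching $m-3$ edges at $v_2$; * $S_3(m,3,k)$, for $k\ge 3$, be obtained from $P$ by attaching $m-3$ edges at one vertex of $e_2\setminus\{v_2,v_3\}$; * $S_4(m,3,k)$, for $m\ge 5$, be obtained from $P$ by attaching $m-4$ edges at $v_2$ and one edge at $v_3$. **Theorem.** 1. Let $k\ge 3$. Up to isomorphism, $\mathbb S(4,3,k)=\{S_1(4,3,k),S_3(4,3,k)\}$, and $q(S_1(4,3,k))>q(S_3(4,3,k))$. 2. Let $k\ge 2$ and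 $m\ge 5$. Then $S_1(m,3,k)$ and $S_4(m,3,k)$ belong to $\mathbb S(m,3,k)$, and $$q(G)<q(S_4(m,3,k))<q(S_1(m,3,k))$$ for every $G\in\mathbb S(m,3,k)$ that is isomorphic neither to $S_1(m,3,k)$ nor to $S_4(m,3,k)$. -/

import Mathlib

/-! Uniform supertrees and their signless Laplacian spectral radius.

A hypergraph is Mathlib's `Hypergraph V`, taken over a finite type `V`; the hypergraphs considered
below have all of `V` as their vertex set. -/

noncomputable section

namespace Supertree

universe u v

/-- `H` is `k`-uniform: every edge has exactly `k` vertices. -/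
def IsUniform {V : Type u} (H : Hypergraph V) (k : ℕ) : Prop :=
  ∀ e ∈ H.edgeSet, e.ncard = k

/-- `w 0, e 0, w 1, …, e (l - 1), w l` is a path of length `l` in `H`: distinct vertices, distinct
edges, and consecutive vertices `w i`, `w (i + 1)` both lie in the edge `e i`. -/
structure IsPath {V : Type u} (H : Hypergraph V) (l : ℕ)
    (w : Fin (l + 1) → V) (e : Fin l → Set V) : Prop where
  vertex_mem : ∀ i, w i ∈ H.vertexSet
  edge_mem : ∀ i, e i ∈ H.edgeSet
  vertex_injective : Function.Injective w
  edge_injective : Function.Injective e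
  left_mem : ∀ i : Fin l, w i.castSucc ∈ e i
  right_mem : ∀ i : Fin l, w i.succ ∈ e i

/-- There is a path of length `l` in `H` from `x` to `y`. -/
def HasPath {V : Type u} (H : Hypergraph V) (x y : V) (l : ℕ) : Prop :=
  ∃ (w : Fin (l + 1) → V) (e : Fin l → Set V),
    IsPath H l w e ∧ w 0 = x ∧ w (Fin.last l) = y

/-- `H` is connected: it has a vertex, and any two vertices are joined by a path. -/
def IsConnected {V : Type u} (H : Hypergraph V) : Prop :=
  H.vertexSet.Nonempty ∧ ∀ x ∈ H.vertexSet, ∀ y ∈ H.vertexSet, ∃ l, HasPath H x y l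

/-- `w 0, e 0, w 1, …, w (l + 1), e (l + 1), w 0` is a (Berge) cycle of length `l + 2` in `H`:
distinct vertices and distinct edges, with `w i` and `w (i + 1)` in `e i` for all `i`, where
`i + 1` is taken modulo `l + 2`. -/
structure IsCycle {V : Type u} (H : Hypergraph V) (l : ℕ)
    (w : Fin (l + 2) → V) (e : Fin (l + 2) → Set V) : Prop where
  edge_mem : ∀ i, e i ∈ H.edgeSet
  vertex_injective : Function.Injective w
  edge_injective : Function.Injective e
  left_mem : ∀ i, w i ∈ e i
  right_mem : ∀ i, w (i + 1) ∈ e i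

/-- `H` has no cycle. (In particular, two different edges share at most one vertex.) -/
def IsAcyclic {V : Type u} (H : Hypergraph V) : Prop :=
  ∀ (l : ℕ) (w : Fin (l + 2) → V) (e : Fin (l + 2) → Set V), ¬ IsCycle H l w e

/-- The distance between two vertices: the length of a shortest path joining them. -/
def dist {V : Type u} (H : Hypergraph V) (x y : V) : ℕ :=
  sInf {l | HasPath H x y l}

/-- The diameter of a (connected) hypergraph with vertex set `V`: the largest distance between two
vertices. -/
def diam {V : Type u} [Fintype V] (H : Hypergraph V) : ℕ :=
  Finset.univ.sup fun p : V × V => dist H p.1 p.2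

/-- The class of `k`-uniform supertrees (connected acyclic hypergraphs) with `m` edges and
diameter `d`. -/
structure MemS {V : Type u} [Fintype V] (m d k : ℕ) (H : Hypergraph V) : Prop where
  vertexSet_eq : H.vertexSet = Set.univ
  uniform : IsUniform H k
  connected : IsConnected H
  acyclic : IsAcyclic H
  edges : H.edgeSet.ncard = m
  diam_eq : diam H = d

/-- Isomorphism of hypergraphs: a bijection of the vertices that carries the hypergraph `G` to the
hypergraph `H`. -/
def Iso {V : Type u} {W : Type v} (G : Hypergraph V) (H : Hypergraph W) : Prop :=
  ∃ φ : V ≃ W, G.image φ = H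

/-! ### Tensors and the signless Laplacian spectral radius -/

/-- Tensors of order `k ≥ 1` over `ℂ` with index set `V`. The first index is kept apart from the
other `k - 1`: `T i f` is the entry with indices `i, f 0, …, f (k - 2)`. -/
abbrev Tensor (V : Type u) (k : ℕ) : Type u := V → (Fin (k - 1) → V) → ℂ

/-- The vector `T x ^ (k - 1)`. -/
def Tensor.app {V : Type u} [Fintype V] {k : ℕ} (T : Tensor V k) (x : V → ℂ) : V → ℂ :=
  fun i => ∑ f : Fin (k - 1) → V, T i f * ∏ j, x (f j)

/-- `μ` is an eigenvalue of `T`: `T x ^ (k - 1) = μ x ^ [k - 1]` for some nonzero complex `x`. -/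
def Tensor.IsEigenvalue {V : Type u} [Fintype V] {k : ℕ} (T : Tensor V k) (μ : ℂ) : Prop :=
  ∃ x : V → ℂ, x ≠ 0 ∧ ∀ i, T.app x i = μ * x i ^ (k - 1)

/-- The spectral radius: the largest modulus of an eigenvalue. -/
def Tensor.spectralRadius {V : Type u} [Fintype V] {k : ℕ} (T : Tensor V k) : ℝ :=
  sSup {r : ℝ | ∃ μ : ℂ, T.IsEigenvalue μ ∧ r = ‖μ‖}

/-- The degree of a vertex: the number of edges that contain it. -/
def degree {V : Type u} (H : Hypergraph V) (x : V) : ℕ :=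
  {e | e ∈ H.edgeSet ∧ x ∈ e}.ncard

open Classical in
/-- The adjacency tensor of a `k`-uniform hypergraph: the entry is `1 / (k - 1)!` if the set of the
`k` indices is an edge, and `0` otherwise. -/
def adjTensor {V : Type u} (H : Hypergraph V) (k : ℕ) : Tensor V k :=
  fun i f => if insert i (Set.range f) ∈ H.edgeSet then 1 / (Nat.factorial (k - 1) : ℂ) else 0

open Classical in
/-- The diagonal tensor of the degrees. -/
def degTensor {V : Type u} (H : Hypergraph V) (k : ℕ) : Tensor V k :=
  fun i f => if ∀ j, f j = i then (degree H i : ℂ) else 0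

/-- The signless Laplacian tensor. -/
def signlessLaplacian {V : Type u} (H : Hypergraph V) (k : ℕ) : Tensor V k :=
  degTensor H k + adjTensor H k

/-- The signless Laplacian spectral radius of a `k`-uniform hypergraph with vertex set `V`. -/
def q {V : Type u} [Fintype V] (k : ℕ) (H : Hypergraph V) : ℝ :=
  (signlessLaplacian H k).spectralRadius

/-! ### The extremal supertrees -/

/-- The `k`-uniform hypergraph on the vertices `0, …, m (k - 1)` built up by attaching, one after
the other, `m` edges: for `i = 0, …, m - 1` the `i`-th edge consists of the vertex `a i` together
with the `k - 1` new vertices `i (k - 1) + 1, …, (i + 1) (k - 1)`.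

With `a i = i (k - 1)` this is the loose path `v₁, e₁, v₂, …, e_m, v_{m+1}`, in which
`v_j` is the number `(j - 1) (k - 1)` and `e_j` is the edge with index `j - 1`. -/
def attach (m k : ℕ) (a : ℕ → ℕ) : Hypergraph (Fin (m * (k - 1) + 1)) where
  vertexSet := Set.univ
  edgeSet := {e | ∃ i < m,
    e = {x | x.val = a i ∨ (i * (k - 1) < x.val ∧ x.val ≤ (i + 1) * (k - 1))}}
  subset_vertexSet_of_mem_edgeSet' := fun _ _ => Set.subset_univ _

/-- The loose path `v₁, e₁, …, e_d, v_{d+1}` with `m - d` further edges attached at the vertex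
`v_{⌊d/2⌋ + 1}`. -/
def S₁ (m d k : ℕ) : Hypergraph (Fin (m * (k - 1) + 1)) :=
  attach m k fun i => if i < d then i * (k - 1) else d / 2 * (k - 1)

/-- The loose path `v₁, e₁, …, e_d, v_{d+1}` (`d` odd) with `m - d` further edges attached at one
pendent vertex of `e_{⌊d/2⌋ + 1}` (such a vertex exists for `k ≥ 3`). -/
def S₃ (m d k : ℕ) : Hypergraph (Fin (m * (k - 1) + 1)) :=
  attach m k fun i => if i < d then i * (k - 1) else d / 2 * (k - 1) + 1

/-- The loose path `v₁, e₁, v₂, e₂, v₃, e₃, v₄` with `m - 4` further edges attached at `v₂` and one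
further edge attached at `v₃` (for `m ≥ 5`). -/
def S₄ (m k : ℕ) : Hypergraph (Fin (m * (k - 1) + 1)) :=
  attach m k fun i =>
    if i < 3 then i * (k - 1) else if i < m - 1 then k - 1 else 2 * (k - 1)

end Supertree

end

noncomputable section

namespace Supertree

universe u v

/-! ### Central edges, and how diameter three forces one. -/

section

/-! A supertree of diameter three looks like a double star. The middle edge `c` of a diametral path
meets every other edge, since an edge missing `c` would lead to a shortest path of length four. By
acyclicity every other edge meets `c` in one vertex, and two of them share no vertex outside `c`. Up
to isomorphism only the profile remains: the multiset of the numbers of further edges at the `k`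
vertices of `c`. It has sum `m - 1` and at least two positive entries (`MemS.exists_isCentral`,
`IsCentral.iso`). Conversely, a hypergraph with such a central edge is a supertree of diameter three
(`IsCentral.memS`), so the named hypergraphs are handled by computing their profiles.

The spectral radius is read off from the profile. Look for a positive eigenvector with eigenvalue `1
+ t`. On the new vertices of an edge attached at a vertex of value `z` it must be `z / t`. At a
vertex of `c` with value `z` and `n` further edges, the eigenvalue equation says that the product of
all values on `c` is `z ^ k * fac k t n`, where `fac k t n = t - n (1 + 1 / t ^ (k - 1))`. With that
product normalised to one, this is solvable in positive numbers exactly when all factors are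
positive and their product over the profile is one. A positive eigenvector always belongs to the
spectral radius, hence `q = 1 + t` (`q_eq_of_pos_eigenvector`, `IsCentral.q_eq`).

Put `r = (1 + 1 / t ^ (k - 1)) / t`. The product of the factors is `t ^ k ∏ (1 - n r)`, and each
factor increases with `t`. So a profile with the smaller `∏ (1 - n r)` has the larger root
(`IsMainRoot.lt_of_prod_lt`), and the ordering becomes an inequality about multisets of positive
integers with given sum. Splitting a part, or balancing two parts, enlarges the product; hence `{m -
2, 1}` and then `{m - 3, 2}` are extremal (`prod_lt_prod_of_ne`). -/

/-- `c` is a central edge of the `k`-uniform hypergraph `H`: every other edge meets `c` in exactly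
one vertex, and the other edges meet each other only inside `c`. -/
structure IsCentral {V : Type u} (H : Hypergraph V) (k : ℕ) (c : Set V) : Prop where
  vertexSet_eq : H.vertexSet = Set.univ
  uniform : IsUniform H k
  mem : c ∈ H.edgeSet
  cover : ∀ v, ∃ e ∈ H.edgeSet, v ∈ e
  inter_center : ∀ f ∈ H.edgeSet, f ≠ c → ∃ x, f ∩ c = {x}
  inter_subset : ∀ f ∈ H.edgeSet, ∀ g ∈ H.edgeSet, f ≠ c → g ≠ c → f ≠ g → f ∩ g ⊆ c

/-! ### The incidence graph -/

/-- The bipartite incidence graph of a hypergraph. -/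
def incidenceGraph {V : Type u} (H : Hypergraph V) : SimpleGraph (V ⊕ Set V) where
  Adj
    | .inl v, .inr e => e ∈ H.edgeSet ∧ v ∈ e
    | .inr e, .inl v => e ∈ H.edgeSet ∧ v ∈ e
    | _, _ => False
  symm := ⟨by rintro (v | e) (v' | e') h <;> simp_all⟩
  loopless := ⟨by rintro (v | e) h <;> simp at h⟩

variable {V : Type u} {H : Hypergraph V}

@[simp] lemma incidenceGraph_inl_inr {v : V} {e : Set V} :
    (incidenceGraph H).Adj (.inl v) (.inr e) ↔ e ∈ H.edgeSet ∧ v ∈ e := Iff.rfl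

@[simp] lemma incidenceGraph_inr_inl {v : V} {e : Set V} :
    (incidenceGraph H).Adj (.inr e) (.inl v) ↔ e ∈ H.edgeSet ∧ v ∈ e := Iff.rfl

@[simp] lemma incidenceGraph_inl_inl {v w : V} :
    ¬ (incidenceGraph H).Adj (.inl v) (.inl w) := fun h => h

@[simp] lemma incidenceGraph_inr_inr {e f : Set V} :
    ¬ (incidenceGraph H).Adj (.inr e) (.inr f) := fun h => h

lemma HasPath.exists_walk {x y : V} {l : ℕ} (h : HasPath H x y l) :
    ∃ p : (incidenceGraph H).Walk (.inl x) (.inl y), p.length = 2 * l := by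
  obtain ⟨w, e, hp, rfl, rfl⟩ := h
  have key : ∀ i : Fin (l + 1), ∃ p : (incidenceGraph H).Walk (.inl (w 0)) (.inl (w i)),
      p.length = 2 * (i : ℕ) := by
    intro i
    induction i using Fin.induction with
    | zero => exact ⟨.nil, rfl⟩
    | succ i ih =>
      obtain ⟨p, hl⟩ := ih
      have h1 : (incidenceGraph H).Adj (.inl (w i.castSucc)) (.inr (e i)) :=
        ⟨hp.edge_mem i, hp.left_mem i⟩
      have h2 : (incidenceGraph H).Adj (.inr (e i)) (.inl (w i.succ)) :=
        ⟨hp.edge_mem i, hp.right_mem i⟩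
      refine ⟨(p.concat h1).concat h2, ?_⟩
      simp [hl]
      ring
  simpa using key (Fin.last l)

/-- Bipartiteness makes a walk alternate, so its even positions can be read as vertices and its odd
positions as edges of the hypergraph. -/
lemma incidenceGraph_getVert {v : V} {b : V ⊕ Set V} (p : (incidenceGraph H).Walk (.inl v) b) :
    ∀ i, (2 * i ≤ p.length → ∃ x, p.getVert (2 * i) = .inl x) ∧
      (2 * i + 1 ≤ p.length → ∃ e, p.getVert (2 * i + 1) = .inr e) := by
  have step : ∀ i x, i < p.length → p.getVert i = .inl x → ∃ e, p.getVert (i + 1) = .inr e := by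
    intro i x hi hx
    have := p.adj_getVert_succ hi
    rw [hx] at this
    rcases h : p.getVert (i + 1) with y | e
    · rw [h] at this; simp at this
    · exact ⟨e, rfl⟩
  have step' : ∀ i e, i < p.length → p.getVert i = .inr e → ∃ x, p.getVert (i + 1) = .inl x := by
    intro i x hi hx
    have := p.adj_getVert_succ hi
    rw [hx] at this
    rcases h : p.getVert (i + 1) with y | e
    · exact ⟨y, rfl⟩
    · rw [h] at this; simp at this
  intro i
  induction i with
  | zero =>
    refine ⟨fun _ => ⟨v, by simp⟩, fun h => step 0 v (by omega) (by simp)⟩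
  | succ i ih =>
    have h1 : 2 * (i + 1) ≤ p.length → ∃ x, p.getVert (2 * (i + 1)) = .inl x := by
      intro h
      obtain ⟨e, he⟩ := ih.2 (by omega)
      exact step' (2 * i + 1) e (by omega) he
    refine ⟨h1, fun h => ?_⟩
    obtain ⟨x, hx⟩ := h1 (by omega)
    exact step (2 * (i + 1)) x (by omega) hx

lemma IsAcyclic.not_isCycle_inl (hH : IsAcyclic H) (v : V)
    (p : (incidenceGraph H).Walk (.inl v) (.inl v)) : ¬ p.IsCycle := by
  intro hp
  obtain ⟨n, hn⟩ : ∃ n, p.length = 2 * n := by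
    rcases Nat.even_or_odd' p.length with ⟨n, h | h⟩
    · exact ⟨n, h⟩
    · obtain ⟨e, he⟩ := (incidenceGraph_getVert p n).2 (by omega)
      rw [← h, p.getVert_length] at he
      simp at he
  have h3 := hp.three_le_length
  -- A graph cycle has at least three steps and here an even number of them, so at least four: the
  -- Berge cycle has length at least two.
  obtain ⟨l, rfl⟩ : ∃ l, n = l + 2 := ⟨n - 2, by lia⟩
  have hw : ∀ i : Fin (l + 2), ∃ x, p.getVert (2 * i) = .inl x := fun i =>
    (incidenceGraph_getVert p i).1 (by have := i.2; omega)
  have he : ∀ i : Fin (l + 2), ∃ e, p.getVert (2 * i + 1) = .inr e := fun i =>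
    (incidenceGraph_getVert p i).2 (by have := i.2; omega)
  choose w hw using hw
  choose e he using he
  have hadj : ∀ i : Fin (l + 2), e i ∈ H.edgeSet ∧ w i ∈ e i := by
    intro i
    have := p.adj_getVert_succ (i := 2 * i) (by have := i.2; omega)
    rwa [hw, he] at this
  have hadj' : ∀ i : Fin (l + 2), w (i + 1) ∈ e i := by
    intro i
    have h := p.adj_getVert_succ (i := 2 * i + 1) (by have := i.2; omega)
    rw [he] at h
    have h2 : p.getVert (2 * i + 1 + 1) = .inl (w (i + 1)) := by
      rw [← hw]
      -- The last index wraps around: `i + 1` is `0` in `Fin (l + 2)`, and the walk is back at its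
      -- base point.
      by_cases hi : i = Fin.last (l + 1)
      · subst hi
        have : 2 * ((Fin.last (l + 1) : Fin (l + 2)) : ℕ) + 1 + 1 = p.length := by
          rw [hn]; simp; ring
        rw [this, p.getVert_length]
        simp
      · congr 1
        rw [Fin.val_add_one_of_lt (Fin.lt_last_iff_ne_last.2 hi)]
        ring
    rw [h2] at h
    exact h.2
  refine hH l w e ⟨fun i => (hadj i).1, fun i j hij => ?_, fun i j hij => ?_,
    fun i => (hadj i).2, hadj'⟩
  · have := hp.getVert_injOn' (x₁ := 2 * i) (x₂ := 2 * j)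
      (show 2 * (i : ℕ) ≤ p.length - 1 by omega) (show 2 * (j : ℕ) ≤ p.length - 1 by omega) (by rw [hw, hw, hij])
    ext; omega
  · have := hp.getVert_injOn' (x₁ := 2 * i + 1) (x₂ := 2 * j + 1)
      (show 2 * (i : ℕ) + 1 ≤ p.length - 1 by omega) (show 2 * (j : ℕ) + 1 ≤ p.length - 1 by omega) (by rw [he, he, hij])
    ext; omega

/-- A cycle based at an edge is rotated to its second node, which is a vertex. -/
lemma IsAcyclic.isAcyclic_incidenceGraph (hH : IsAcyclic H) : (incidenceGraph H).IsAcyclic := by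
  classical
  rintro (v | e) p hp
  · exact hH.not_isCycle_inl v p hp
  · have h3 := hp.three_le_length
    rcases h : p.snd with v | f
    · have hm : p.snd ∈ p.support := p.getVert_mem_support 1
      rw [h] at hm
      exact hH.not_isCycle_inl v _ (hp.rotate hm)
    · have := p.adj_snd hp.not_nil
      rw [h] at this
      simp at this

lemma IsAcyclic.eq_of_mem_inter (hH : IsAcyclic H) {e f : Set V} (he : e ∈ H.edgeSet)
    (hf : f ∈ H.edgeSet) (hef : e ≠ f) {x y : V} (hxe : x ∈ e) (hxf : x ∈ f) (hye : y ∈ e)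
    (hyf : y ∈ f) : x = y := by
  by_contra hxy
  refine hH 0 ![x, y] ![e, f] ⟨?_, ?_, ?_, ?_, ?_⟩
  · simp [Fin.forall_fin_two, he, hf]
  · intro i j; fin_cases i <;> fin_cases j <;> simp [hxy, Ne.symm hxy]
  · intro i j; fin_cases i <;> fin_cases j <;> simp [hef, hef.symm]
  · simp [Fin.forall_fin_two, hxe, hyf]
  · simp [Fin.forall_fin_two, hxf, hye]

lemma IsAcyclic.not_triangle (hH : IsAcyclic H) {e f g : Set V} (he : e ∈ H.edgeSet)
    (hf : f ∈ H.edgeSet) (hg : g ∈ H.edgeSet) (hef : e ≠ f) (hfg : f ≠ g) (heg : e ≠ g)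
    {x y z : V} (hxy : x ≠ y) (hyz : y ≠ z) (hxz : x ≠ z) (hxe : x ∈ e) (hye : y ∈ e)
    (hyf : y ∈ f) (hzf : z ∈ f) (hzg : z ∈ g) (hxg : x ∈ g) : False := by
  refine hH 1 ![x, y, z] ![e, f, g] ⟨?_, ?_, ?_, ?_, ?_⟩
  · simp [Fin.forall_fin_succ, he, hf, hg]
  · intro i j
    fin_cases i <;> fin_cases j <;> simp [hxy, hyz, hxz, hxy.symm, hyz.symm, hxz.symm]
  · intro i j
    fin_cases i <;> fin_cases j <;> simp [hef, hfg, heg, hef.symm, hfg.symm, heg.symm]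
  · simp [Fin.forall_fin_succ, hxe, hyf, hzg]
  · intro i; fin_cases i <;> simp <;> assumption

/-- In an acyclic hypergraph, a nonbacktracking walk of length `4` is a shortest path. -/
lemma IsAcyclic.four_le_of_hasPath (hH : IsAcyclic H) {x₀ x₁ x₂ x₃ x₄ : V} {e₁ e₂ e₃ e₄ : Set V}
    (h₁ : e₁ ∈ H.edgeSet) (h₂ : e₂ ∈ H.edgeSet) (h₃ : e₃ ∈ H.edgeSet) (h₄ : e₄ ∈ H.edgeSet)
    (l₁ : x₀ ∈ e₁) (r₁ : x₁ ∈ e₁) (l₂ : x₁ ∈ e₂) (r₂ : x₂ ∈ e₂) (l₃ : x₂ ∈ e₃) (r₃ : x₃ ∈ e₃)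
    (l₄ : x₃ ∈ e₄) (r₄ : x₄ ∈ e₄) (n₁ : x₀ ≠ x₁) (n₂ : x₁ ≠ x₂) (n₃ : x₂ ≠ x₃) (n₄ : x₃ ≠ x₄)
    (d₁ : e₁ ≠ e₂) (d₂ : e₂ ≠ e₃) (d₃ : e₃ ≠ e₄) {l : ℕ} (h : HasPath H x₀ x₄ l) : 4 ≤ l := by
  classical
  obtain ⟨p, hp⟩ := h.exists_walk
  have a₁ : (incidenceGraph H).Adj (.inl x₀) (.inr e₁) := ⟨h₁, l₁⟩
  have b₁ : (incidenceGraph H).Adj (.inr e₁) (.inl x₁) := ⟨h₁, r₁⟩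
  have a₂ : (incidenceGraph H).Adj (.inl x₁) (.inr e₂) := ⟨h₂, l₂⟩
  have b₂ : (incidenceGraph H).Adj (.inr e₂) (.inl x₂) := ⟨h₂, r₂⟩
  have a₃ : (incidenceGraph H).Adj (.inl x₂) (.inr e₃) := ⟨h₃, l₃⟩
  have b₃ : (incidenceGraph H).Adj (.inr e₃) (.inl x₃) := ⟨h₃, r₃⟩
  have a₄ : (incidenceGraph H).Adj (.inl x₃) (.inr e₄) := ⟨h₄, l₄⟩
  have b₄ : (incidenceGraph H).Adj (.inr e₄) (.inl x₄) := ⟨h₄, r₄⟩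
  let r : (incidenceGraph H).Walk (.inl x₀) (.inl x₄) :=
    .cons a₁ (.cons b₁ (.cons a₂ (.cons b₂ (.cons a₃ (.cons b₃ (.cons a₄ (.cons b₄ .nil)))))))
  have hr : r.IsPath := by
    rw [hH.isAcyclic_incidenceGraph.isPath_iff_isChain]
    simp [r, n₁, n₂, n₃, n₄, d₁, d₂, d₃]
  -- Paths in a forest are unique, so shortening `p` to a path yields `r`, whence `8 ≤ 2 * l`.
  have := congrArg (fun q : (incidenceGraph H).Path _ _ => q.1.length)
    ((hH.isAcyclic_incidenceGraph.subsingleton_path _ _).elim ⟨r, hr⟩ p.toPath)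
  have h2 := p.length_bypass_le_length
  have h8 : r.length = 8 := rfl
  simp only [SimpleGraph.Walk.toPath] at this
  omega

/-! ### Supertrees of diameter three have a central edge -/

/-- Connectedness matters because the infimum of the empty set is `0`. -/
lemma IsConnected.hasPath_dist (h : IsConnected H) (hV : H.vertexSet = Set.univ) (x y : V) :
    HasPath H x y (dist H x y) :=
  Nat.sInf_mem (s := {l | HasPath H x y l}) (h.2 x (hV ▸ trivial) y (hV ▸ trivial))

lemma dist_le_diam [Fintype V] (H : Hypergraph V) (x y : V) : dist H x y ≤ diam H :=
  Finset.le_sup (f := fun p : V × V => dist H p.1 p.2) (Finset.mem_univ (x, y))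

/-- In a connected hypergraph, if some edge misses `c`, then some edge that misses `c` meets an
edge that meets `c`. -/
lemma IsConnected.exists_second_neighbour (h : IsConnected H) {c f : Set V}
    (hc : c ∈ H.edgeSet) (hf : f ∈ H.edgeSet) (hcn : c.Nonempty) (hfn : f.Nonempty)
    (hfc : Disjoint f c) :
    ∃ f' ∈ H.edgeSet, ∃ g ∈ H.edgeSet, ∃ y ∈ f', y ∈ g ∧ Disjoint f' c ∧ ∃ a ∈ g, a ∈ c := by
  obtain ⟨z, hz⟩ := hfn
  obtain ⟨u, hu⟩ := hcn
  obtain ⟨l, w, e, hp, rfl, rfl⟩ := h.2 u (H.subset_vertexSet_of_mem_edgeSet' hc hu) z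
    (H.subset_vertexSet_of_mem_edgeSet' hf hz)
  by_contra hcon
  push Not at hcon
  have key : ∀ i, ∃ g ∈ H.edgeSet, w i ∈ g ∧ ∃ a ∈ g, a ∈ c := by
    intro i
    induction i using Fin.induction with
    | zero => exact ⟨c, hc, hu, _, hu, hu⟩
    | succ i ih =>
      obtain ⟨g, hg, hw, a, hag, hac⟩ := ih
      by_cases hd : Disjoint (e i) c
      · exact absurd hac (hcon _ (hp.edge_mem i) g hg _ (hp.left_mem i) hw hd a hag)
      · obtain ⟨b, hb, hb'⟩ := Set.not_disjoint_iff.1 hd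
        exact ⟨e i, hp.edge_mem i, hp.right_mem i, b, hb, hb'⟩
  obtain ⟨g, hg, hw, a, hag, hac⟩ := key (Fin.last l)
  exact hcon f hf g hg _ hz hw hfc a hag hac

/-- The central edge is the middle edge of a path realising the diameter; its first and last edges
are the further edges at `x` and `y`. -/
theorem MemS.exists_isCentral [Fintype V] {m k : ℕ} (hk : 2 ≤ k) (h : MemS m 3 k H) :
    ∃ c, IsCentral H k c ∧ ∃ x ∈ c, ∃ y ∈ c, x ≠ y ∧
      (∃ f ∈ H.edgeSet, f ≠ c ∧ x ∈ f) ∧ ∃ g ∈ H.edgeSet, g ≠ c ∧ y ∈ g := by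
  obtain ⟨hV, hu, hconn, hac, -, hd⟩ := h
  obtain ⟨v₀, -⟩ := hconn.1
  obtain ⟨⟨x, y⟩, -, hxy⟩ := Finset.exists_mem_eq_sup (Finset.univ : Finset (V × V))
    ⟨(v₀, v₀), Finset.mem_univ _⟩ (fun p => dist H p.1 p.2)
  have hpath := hconn.hasPath_dist hV x y
  rw [show dist H x y = 3 from hxy.symm.trans hd] at hpath
  obtain ⟨w, e, hp, rfl, rfl⟩ := hpath
  have hnt : ∀ f ∈ H.edgeSet, ∀ a : V, ∃ b ∈ f, b ≠ a := fun f hf a =>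
    Set.exists_ne_of_one_lt_ncard (by rw [hu f hf]; omega) a
  have hn : ∀ f ∈ H.edgeSet, f.Nonempty := fun f hf => by
    obtain ⟨b, hb, -⟩ := hnt f hf v₀
    exact ⟨b, hb⟩
  have e01 : e 0 ≠ e 1 := hp.edge_injective.ne (by decide)
  have e21 : e 2 ≠ e 1 := hp.edge_injective.ne (by decide)
  have w12 : w 1 ≠ w 2 := hp.vertex_injective.ne (by decide)
  -- If some edge misses `e 1`, there is an edge `f'` missing it and joined to it by an edge `g`
  -- that meets it at `a`.
  have meets : ∀ f ∈ H.edgeSet, ¬ Disjoint f (e 1) := by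
    intro f hf hdis
    obtain ⟨f', hf', g, hg, y, hyf, hyg, hdis', a, hag, hac'⟩ :=
      hconn.exists_second_neighbour (hp.edge_mem 1) hf (hn _ (hp.edge_mem 1)) (hn _ hf) hdis
    obtain ⟨z, hz, hzy⟩ := hnt f' hf' y
    have hyc : y ∉ e 1 := Set.disjoint_left.1 hdis' hyf
    have hfg : f' ≠ g := by
      rintro rfl
      exact Set.disjoint_left.1 hdis' hag hac'
    have hgc : g ≠ e 1 := by
      rintro rfl
      exact hyc hyg
    have hya : y ≠ a := by
      rintro rfl
      exact hyc hac'
    -- Go from `z` through `f'`, `g`, `e 1` and then an outer edge `e₃` of the diametral path: four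
    -- nonbacktracking steps, against diameter three. At least one of `w 1`, `w 2` differs from `a`,
    -- so an outer edge is always available.
    have fin : ∀ u v : V, ∀ e₃ ∈ H.edgeSet, e 1 ≠ e₃ → u ∈ e 1 → u ∈ e₃ → v ∈ e₃ → u ≠ v →
        a ≠ u → False := by
      intro u v e₃ he₃ hce h1 h2 h3 huv hau
      have := hac.four_le_of_hasPath hf' hg (hp.edge_mem 1) he₃ hz hyf hyg hag hac' h1 h2 h3 hzy
        hya hau huv hfg hgc hce (hconn.hasPath_dist hV z v)
      have := dist_le_diam H z v
      omega
    by_cases ha : a = w 1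
    · exact fin (w 2) (w 3) (e 2) (hp.edge_mem 2) e21.symm (hp.right_mem 1) (hp.left_mem 2)
        (hp.right_mem 2) (hp.vertex_injective.ne (by decide)) (ha ▸ w12)
    · exact fin (w 1) (w 0) (e 0) (hp.edge_mem 0) e01.symm (hp.left_mem 1) (hp.right_mem 0)
        (hp.left_mem 0) (hp.vertex_injective.ne (by decide)) ha
  refine ⟨e 1, ⟨hV, hu, hp.edge_mem 1, ?_, ?_, ?_⟩, w 1, hp.left_mem 1, w 2, hp.right_mem 1, w12,
    ⟨e 0, hp.edge_mem 0, e01, hp.right_mem 0⟩, ⟨e 2, hp.edge_mem 2, e21, hp.left_mem 2⟩⟩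
  · intro v
    obtain ⟨y, hy⟩ : ∃ y, v ≠ y := by
      by_cases hv : v = w 1
      · exact ⟨w 2, hv ▸ w12⟩
      · exact ⟨_, hv⟩
    obtain ⟨l, w', e', hp', rfl, rfl⟩ := hconn.2 v (hV ▸ trivial) y (hV ▸ trivial)
    rcases l with _ | l
    · exact absurd rfl hy
    · exact ⟨e' 0, hp'.edge_mem 0, hp'.left_mem 0⟩
  · intro f hf hfc
    obtain ⟨x, hx, hx'⟩ := Set.not_disjoint_iff.1 (meets f hf)
    refine ⟨x, Set.eq_singleton_iff_unique_mem.2 ⟨⟨hx, hx'⟩, fun y hy => ?_⟩⟩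
    exact hac.eq_of_mem_inter hf (hp.edge_mem 1) hfc hy.1 hy.2 hx hx'
  · rintro f hf g hg hfc hgc hfg y ⟨hyf, hyg⟩
    by_contra hyc
    obtain ⟨a, haf, hac'⟩ := Set.not_disjoint_iff.1 (meets f hf)
    obtain ⟨b, hbg, hbc⟩ := Set.not_disjoint_iff.1 (meets g hg)
    have hya : y ≠ a := fun h => hyc (h ▸ hac')
    have hyb : y ≠ b := fun h => hyc (h ▸ hbc)
    by_cases hab : a = b
    · subst hab
      exact hya (hac.eq_of_mem_inter hf hg hfg hyf hyg haf hbg)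
    · exact hac.not_triangle hf hg (hp.edge_mem 1) hfg hgc hfc hya.symm hyb hab haf hyf hyg hbg
        hbc hac'

end

section

variable {V : Type u} {H : Hypergraph V} {k : ℕ} {c : Set V}

/-! ### Hypergraphs with a central edge are supertrees of diameter at most three -/

lemma hasPath_zero (hx : H.vertexSet = Set.univ) (x : V) : HasPath H x x 0 :=
  ⟨fun _ => x, Fin.elim0, ⟨fun _ => hx ▸ trivial, fun i => i.elim0,
    fun i j _ => Subsingleton.elim (α := Fin 1) i j, fun i => i.elim0, fun i => i.elim0,
    fun i => i.elim0⟩, rfl, rfl⟩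

lemma hasPath_one (hV : H.vertexSet = Set.univ) {x y : V} {e : Set V} (he : e ∈ H.edgeSet)
    (hx : x ∈ e) (hy : y ∈ e) (hxy : x ≠ y) : HasPath H x y 1 := by
  refine ⟨![x, y], ![e], ⟨fun _ => hV ▸ trivial, ?_, ?_, ?_, ?_, ?_⟩, rfl, rfl⟩
  · simpa
  · intro i j; fin_cases i <;> fin_cases j <;> simp [hxy, hxy.symm]
  · exact Function.injective_of_subsingleton _
  · simpa
  · simpa

lemma hasPath_two (hV : H.vertexSet = Set.univ) {x y z : V} {e f : Set V} (he : e ∈ H.edgeSet)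
    (hf : f ∈ H.edgeSet) (hef : e ≠ f) (hx : x ∈ e) (hy : y ∈ e) (hy' : y ∈ f) (hz : z ∈ f)
    (hxy : x ≠ y) (hyz : y ≠ z) (hxz : x ≠ z) : HasPath H x z 2 := by
  refine ⟨![x, y, z], ![e, f], ⟨fun _ => hV ▸ trivial, ?_, ?_, ?_, ?_, ?_⟩, rfl, rfl⟩
  · simp [Fin.forall_fin_succ, he, hf]
  · intro i j
    fin_cases i <;> fin_cases j <;> simp [hxy, hxy.symm, hyz, hyz.symm, hxz, hxz.symm]
  · intro i j; fin_cases i <;> fin_cases j <;> simp [hef, hef.symm]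
  · simp [Fin.forall_fin_succ, hx, hy']
  · simp [Fin.forall_fin_succ, hy, hz]

lemma hasPath_three (hV : H.vertexSet = Set.univ) {x y z t : V} {e f g : Set V}
    (he : e ∈ H.edgeSet) (hf : f ∈ H.edgeSet) (hg : g ∈ H.edgeSet) (hef : e ≠ f) (hfg : f ≠ g)
    (heg : e ≠ g) (hx : x ∈ e) (hy : y ∈ e) (hy' : y ∈ f) (hz : z ∈ f) (hz' : z ∈ g) (ht : t ∈ g)
    (hxy : x ≠ y) (hxz : x ≠ z) (hxt : x ≠ t) (hyz : y ≠ z) (hyt : y ≠ t) (hzt : z ≠ t) :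
    HasPath H x t 3 := by
  refine ⟨![x, y, z, t], ![e, f, g], ⟨fun _ => hV ▸ trivial, ?_, ?_, ?_, ?_, ?_⟩, rfl, rfl⟩
  · simp [Fin.forall_fin_succ, he, hf, hg]
  · intro i j
    fin_cases i <;> fin_cases j <;> simp [hxy, hxy.symm, hyz, hyz.symm, hxz, hxz.symm,
      hxt, hxt.symm, hyt, hyt.symm, hzt, hzt.symm]
  · intro i j
    fin_cases i <;> fin_cases j <;> simp [hef, hef.symm, hfg, hfg.symm, heg, heg.symm]
  · simp [Fin.forall_fin_succ, hx, hy', hz']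
  · simp [Fin.forall_fin_succ, hy, hz, ht]

namespace IsCentral

lemma eq_of_notMem (h : IsCentral H k c) {v : V} (hv : v ∉ c) {f g : Set V}
    (hf : f ∈ H.edgeSet) (hg : g ∈ H.edgeSet) (hvf : v ∈ f) (hvg : v ∈ g) : f = g := by
  by_contra hfg
  exact hv (h.inter_subset f hf g hg (fun e => hv (e ▸ hvf)) (fun e => hv (e ▸ hvg)) hfg
    ⟨hvf, hvg⟩)

lemma exists_attach (h : IsCentral H k c) {f : Set V} (hf : f ∈ H.edgeSet) (hfc : f ≠ c) :
    ∃ x ∈ c, x ∈ f ∧ ∀ y ∈ c, y ∈ f → y = x := by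
  obtain ⟨x, hx⟩ := h.inter_center f hf hfc
  have hx' : x ∈ f ∩ c := hx ▸ rfl
  exact ⟨x, hx'.2, hx'.1, fun y hy hy' => (hx ▸ ⟨hy', hy⟩ : y ∈ ({x} : Set V))⟩

lemma eq_of_mem (h : IsCentral H k c) {f : Set V} (hf : f ∈ H.edgeSet) (hfc : f ≠ c) {x y : V}
    (hx : x ∈ c) (hx' : x ∈ f) (hy : y ∈ c) (hy' : y ∈ f) : x = y := by
  obtain ⟨z, -, -, hz⟩ := h.exists_attach hf hfc
  rw [hz x hx hx', hz y hy hy']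

lemma exists_edge (h : IsCentral H k c) {v : V} (hv : v ∉ c) :
    ∃ f ∈ H.edgeSet, f ≠ c ∧ v ∈ f ∧ ∃ a ∈ c, a ∈ f ∧ v ≠ a := by
  obtain ⟨f, hf, hvf⟩ := h.cover v
  have hfc : f ≠ c := fun e => hv (e ▸ hvf)
  obtain ⟨a, hac, haf, -⟩ := h.exists_attach hf hfc
  exact ⟨f, hf, hfc, hvf, a, hac, haf, fun e => hv (e ▸ hac)⟩

lemma exists_hasPath_le_three (h : IsCentral H k c) (x y : V) :
    ∃ l ≤ 3, HasPath H x y l := by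
  have hV := h.vertexSet_eq
  by_cases hxy : x = y
  · exact ⟨0, by omega, hxy ▸ hasPath_zero hV x⟩
  by_cases hcom : ∃ e ∈ H.edgeSet, x ∈ e ∧ y ∈ e
  · obtain ⟨e, he, hx, hy⟩ := hcom
    exact ⟨1, by omega, hasPath_one hV he hx hy hxy⟩
  push Not at hcom
  by_cases hx : x ∈ c
  · have hy : y ∉ c := hcom c h.mem hx
    obtain ⟨g, hg, hgc, hyg, b, hbc, hbg, hyb⟩ := h.exists_edge hy
    have hxb : x ≠ b := fun e => hcom g hg (e ▸ hbg) hyg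
    exact ⟨2, by omega, hasPath_two hV h.mem hg hgc.symm hx hbc hbg hyg hxb hyb.symm hxy⟩
  obtain ⟨f, hf, hfc, hxf, a, hac, haf, hxa⟩ := h.exists_edge hx
  have hya : y ≠ a := fun e => hcom f hf hxf (e ▸ haf)
  by_cases hy : y ∈ c
  · exact ⟨2, by omega, hasPath_two hV hf h.mem hfc hxf haf hac hy hxa hya.symm hxy⟩
  obtain ⟨g, hg, hgc, hyg, b, hbc, hbg, hyb⟩ := h.exists_edge hy
  have hfg : f ≠ g := fun e => hcom f hf hxf (e ▸ hyg)
  have hxb : x ≠ b := fun e => hx (e ▸ hbc)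
  by_cases hab : a = b
  · subst hab
    exact ⟨2, by omega, hasPath_two hV hf hg hfg hxf haf hbg hyg hxa hyb.symm hxy⟩
  · exact ⟨3, le_rfl, hasPath_three hV hf h.mem hg hfc hgc.symm hfg hxf haf hac hbc hbg hyg hxa hxb
      hxy hab hya.symm hyb.symm⟩

lemma isConnected (h : IsCentral H k c) (hk : 1 ≤ k) : IsConnected H := by
  have hc : c.Nonempty := by
    rw [Set.nonempty_iff_ne_empty]
    rintro rfl
    have := h.uniform _ h.mem
    simp at this
    omega
  refine ⟨hc.mono (H.subset_vertexSet_of_mem_edgeSet' h.mem), fun x _ y _ => ?_⟩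
  obtain ⟨l, -, hl⟩ := h.exists_hasPath_le_three x y
  exact ⟨l, hl⟩

/-- Each vertex of a cycle lies in two different edges, hence in `c`. Each edge of the cycle then
contains two vertices of `c`, hence is `c`, although the edges are distinct. -/
lemma isAcyclic (h : IsCentral H k c) : IsAcyclic H := by
  intro l w e hw
  have hne : ∀ i : Fin (l + 2), i + 1 ≠ i := fun i => by simp
  have hmem : ∀ i, w (i + 1) ∈ c := by
    intro i
    by_contra hc
    have := h.eq_of_notMem hc (hw.edge_mem i) (hw.edge_mem (i + 1)) (hw.right_mem i)
      (hw.left_mem (i + 1))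
    exact hne i (hw.edge_injective this).symm
  have hmem' : ∀ i, w i ∈ c := fun i => by simpa using hmem (i - 1)
  have hec : ∀ i, e i = c := by
    intro i
    by_contra hc
    have := h.eq_of_mem (hw.edge_mem i) hc (hmem i) (hw.right_mem i) (hmem' i) (hw.left_mem i)
    exact hne i (hw.vertex_injective this)
  exact hne 0 (hw.edge_injective ((hec (0 + 1)).trans (hec 0).symm))

lemma diam_eq_three [Fintype V] (h : IsCentral H k c) (hk : 2 ≤ k) {a b : V} (ha : a ∈ c)
    (hb : b ∈ c) (hab : a ≠ b) {f g : Set V} (hf : f ∈ H.edgeSet) (hg : g ∈ H.edgeSet)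
    (hfc : f ≠ c) (hgc : g ≠ c) (haf : a ∈ f) (hbg : b ∈ g) : diam H = 3 := by
  have hconn := h.isConnected (by omega)
  apply le_antisymm
  · refine Finset.sup_le fun p _ => ?_
    obtain ⟨l, hl, hp⟩ := h.exists_hasPath_le_three p.1 p.2
    exact (Nat.sInf_le (s := {l | HasPath H p.1 p.2 l}) hp).trans hl
  · have hnt : ∀ f ∈ H.edgeSet, ∀ a : V, ∃ b ∈ f, b ≠ a := fun f hf a =>
      Set.exists_ne_of_one_lt_ncard (by rw [h.uniform f hf]; omega) a
    obtain ⟨x, hxf, hxa⟩ := hnt f hf a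
    obtain ⟨y, hyg, hyb⟩ := hnt g hg b
    have hxc : x ∉ c := fun hx => hxa (h.eq_of_mem hf hfc hx hxf ha haf)
    have hyc : y ∉ c := fun hy => hyb (h.eq_of_mem hg hgc hy hyg hb hbg)
    have hfg : f ≠ g := by
      rintro rfl
      exact hab (h.eq_of_mem hf hfc ha haf hb hbg)
    refine le_trans ?_ (dist_le_diam H x y)
    have hp := hconn.hasPath_dist h.vertexSet_eq x y
    obtain ⟨w, e, hw, hw0, hwl⟩ := hp
    generalize dist H x y = l at *
    by_contra hl
    -- As `x` and `y` lie outside `c`, each lies in a single edge. A path from `x` to `y` therefore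
    -- starts with `f` and ends with `g`, which excludes lengths up to two.
    have hfirst : ∀ i : Fin l, w i.castSucc = x → e i = f := fun i hi =>
      h.eq_of_notMem hxc (hw.edge_mem i) hf (hi ▸ hw.left_mem i) hxf
    have hlast : ∀ i : Fin l, w i.succ = y → e i = g := fun i hi =>
      h.eq_of_notMem hyc (hw.edge_mem i) hg (hi ▸ hw.right_mem i) hyg
    have hl3 : l = 0 ∨ l = 1 ∨ l = 2 := by omega
    rcases hl3 with rfl | rfl | rfl
    · have hxy : x = y := hw0.symm.trans hwl
      subst hxy
      exact hfg (h.eq_of_notMem hxc hf hg hxf hyg)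
    · exact hfg ((hfirst 0 hw0).symm.trans (hlast 0 hwl))
    · have e0 : e 0 = f := hfirst 0 hw0
      have e1 : e 1 = g := hlast 1 hwl
      have h1 : w 1 ∈ f := e0 ▸ hw.right_mem 0
      have h2 : w 1 ∈ g := e1 ▸ hw.left_mem 1
      have h3 := h.inter_subset f hf g hg hfc hgc hfg ⟨h1, h2⟩
      exact hab ((h.eq_of_mem hf hfc ha haf h3 h1).trans (h.eq_of_mem hg hgc h3 h2 hb hbg))

theorem memS [Fintype V] (h : IsCentral H k c) (hk : 2 ≤ k) {a b : V} (ha : a ∈ c)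
    (hb : b ∈ c) (hab : a ≠ b) {f g : Set V} (hf : f ∈ H.edgeSet) (hg : g ∈ H.edgeSet)
    (hfc : f ≠ c) (hgc : g ≠ c) (haf : a ∈ f) (hbg : b ∈ g) :
    MemS H.edgeSet.ncard 3 k H :=
  ⟨h.vertexSet_eq, h.uniform, h.isConnected (by omega), h.isAcyclic, rfl,
    h.diam_eq_three hk ha hb hab hf hg hfc hgc haf hbg⟩

end IsCentral

end

section

/-! ### The attachment numbers of a central edge determine the hypergraph -/

/-- The number of edges other than `c` that contain the vertex `x`. -/
def pend {V : Type u} (H : Hypergraph V) (c : Set V) (x : V) : ℕ :=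
  {f | f ∈ H.edgeSet ∧ f ≠ c ∧ x ∈ f}.ncard

open Classical in
/-- The multiset of the numbers of further edges at the vertices of `c`. -/
def profile {V : Type u} [Fintype V] (H : Hypergraph V) (c : Set V) : Multiset ℕ :=
  c.toFinset.val.map (pend H c)

/-- Glues bijections of equinumerous fibres; the isomorphism in `IsCentral.iso` comes from three
uses of it. -/
lemma exists_equiv_of_card_fiber {α β ι κ : Type*} [Finite α] [Finite β] (p : α → ι) (r : β → κ)
    (τ : ι ≃ κ) (h : ∀ i, Nat.card {a // p a = i} = Nat.card {b // r b = τ i}) :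
    ∃ φ : α ≃ β, ∀ a, r (φ a) = τ (p a) := by
  have e : ∀ i, Nonempty ({a // p a = i} ≃ {b // r b = τ i}) := fun i =>
    (Finite.card_eq).1 (h i)
  refine ⟨(Equiv.sigmaFiberEquiv p).symm.trans ((Equiv.sigmaCongr τ fun i => (e i).some).trans
    (Equiv.sigmaFiberEquiv r)), fun a => ?_⟩
  exact ((e (p a)).some ⟨a, rfl⟩).2

variable {V : Type u} {H : Hypergraph V} {k : ℕ} {c : Set V}

namespace IsCentral

/-- The vertex of `c` at which a further edge is attached. -/
def root (h : IsCentral H k c) (f : {f // f ∈ H.edgeSet ∧ f ≠ c}) : c :=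
  ⟨(h.exists_attach f.2.1 f.2.2).choose, (h.exists_attach f.2.1 f.2.2).choose_spec.1⟩

lemma root_mem (h : IsCentral H k c) (f : {f // f ∈ H.edgeSet ∧ f ≠ c}) :
    (h.root f : V) ∈ f.1 :=
  (h.exists_attach f.2.1 f.2.2).choose_spec.2.1

lemma root_eq_iff (h : IsCentral H k c) (f : {f // f ∈ H.edgeSet ∧ f ≠ c}) (x : c) :
    h.root f = x ↔ (x : V) ∈ f.1 := by
  refine ⟨fun e => e ▸ h.root_mem f, fun e => ?_⟩
  exact Subtype.ext (h.eq_of_mem f.2.1 f.2.2 (h.root f).2 (h.root_mem f) x.2 e)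

lemma card_root_fiber (h : IsCentral H k c) (x : c) :
    Nat.card {f // h.root f = x} = pend H c x := by
  rw [pend, ← Nat.card_coe_set_eq]
  refine Nat.card_congr ⟨fun f => ⟨f.1.1, f.1.2.1, f.1.2.2, (h.root_eq_iff _ _).1 f.2⟩,
    fun f => ⟨⟨f.1, f.2.1, f.2.2.1⟩, (h.root_eq_iff _ _).2 f.2.2.2⟩, fun _ => rfl, fun _ => rfl⟩

lemma sum_profile [Fintype V] (h : IsCentral H k c) :
    (profile H c).sum + 1 = H.edgeSet.ncard := by
  classical
  have h1 : (profile H c).sum = Nat.card {f // f ∈ H.edgeSet ∧ f ≠ c} := by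
    rw [← Nat.card_congr (Equiv.sigmaFiberEquiv h.root), Nat.card_sigma]
    simp only [h.card_root_fiber]
    rw [profile]
    change ∑ x ∈ c.toFinset, pend H c x = _
    exact (Finset.sum_subtype _ (by simp) _)
  rw [h1]
  have h2 : Nat.card {f // f ∈ H.edgeSet ∧ f ≠ c} = (H.edgeSet \ {c}).ncard :=
    Nat.card_coe_set_eq (H.edgeSet \ {c})
  rw [h2, Set.ncard_sdiff_singleton_add_one h.mem]

lemma card_profile [Fintype V] (h : IsCentral H k c) : (profile H c).card = k := by
  classical
  rw [profile, Multiset.card_map, Finset.card_val, ← Set.ncard_eq_toFinset_card', h.uniform c h.mem]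

/-- If the vertices of `t` carry all the edges other than `c`, the profile is read off from `t`. -/
lemma profile_eq [Fintype V] (h : IsCentral H k c) (t : Finset V) (htc : ∀ x ∈ t, x ∈ c)
    (hs : ∑ x ∈ t, pend H c x + 1 = H.edgeSet.ncard) :
    profile H c = t.val.map (pend H c) + Multiset.replicate (k - t.card) 0 := by
  classical
  have hsub : t ⊆ c.toFinset := fun x hx => by simpa using htc x hx
  have hsum := h.sum_profile
  have hcard := h.card_profile
  have hsplit : profile H c =
      t.val.map (pend H c) + (c.toFinset \ t).val.map (pend H c) := by
    rw [profile, ← Multiset.map_add]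
    congr 1
    rw [← Finset.disjUnion_val t (c.toFinset \ t) Finset.disjoint_sdiff,
      Finset.disjUnion_eq_union, Finset.union_sdiff_of_subset hsub]
  rw [hsplit] at hsum hcard ⊢
  congr 1
  rw [Multiset.sum_add] at hsum
  have h0 : ((c.toFinset \ t).val.map (pend H c)).sum = 0 := by
    have : (t.val.map (pend H c)).sum = ∑ x ∈ t, pend H c x := rfl
    omega
  rw [Multiset.eq_replicate]
  constructor
  · simp only [Multiset.card_add, Multiset.card_map, Finset.card_val] at hcard ⊢
    omega
  · intro b hb
    have := Multiset.single_le_sum (fun _ _ => Nat.zero_le _) b hb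
    omega

lemma degree_of_mem [Fintype V] (h : IsCentral H k c) {x : V} (hx : x ∈ c) :
    degree H x = pend H c x + 1 := by
  rw [degree, pend]
  have : {e | e ∈ H.edgeSet ∧ x ∈ e} = insert c {f | f ∈ H.edgeSet ∧ f ≠ c ∧ x ∈ f} := by
    ext e
    by_cases he : e = c
    · subst he; simp [h.mem, hx]
    · simp [he]
  rw [this, Set.ncard_insert_of_notMem (by simp) (Set.toFinite _)]

lemma degree_of_notMem [Fintype V] (h : IsCentral H k c) {x : V} (hx : x ∉ c) :
    degree H x = 1 := by
  obtain ⟨f, hf, hxf⟩ := h.cover x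
  rw [degree, Set.ncard_eq_one]
  refine ⟨f, Set.eq_singleton_iff_unique_mem.2 ⟨⟨hf, hxf⟩, fun g hg => ?_⟩⟩
  exact h.eq_of_notMem hx hg.1 hf hg.2 hxf

open Classical in
/-- A vertex of `c` is labelled by itself, any other vertex by the edge that contains it. -/
def label (h : IsCentral H k c) (x : V) : c ⊕ {f // f ∈ H.edgeSet ∧ f ≠ c} :=
  if hx : x ∈ c then .inl ⟨x, hx⟩
  else .inr ⟨(h.exists_edge hx).choose, (h.exists_edge hx).choose_spec.1,
    (h.exists_edge hx).choose_spec.2.1⟩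

lemma label_eq_inl (h : IsCentral H k c) {x : V} {y : c} : h.label x = .inl y ↔ x = y := by
  unfold label
  split_ifs with hx
  · simp [Subtype.ext_iff]
  · simp only [false_iff]
    rintro rfl
    exact hx y.2

lemma label_eq_inr (h : IsCentral H k c) {x : V} {f : {f // f ∈ H.edgeSet ∧ f ≠ c}} :
    h.label x = .inr f ↔ x ∉ c ∧ x ∈ f.1 := by
  unfold label
  split_ifs with hx
  · simp [hx]
  · have hs := (h.exists_edge hx).choose_spec
    simp only [Sum.inr.injEq, hx, not_false_eq_true, true_and]
    constructor
    · rintro rfl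
      exact hs.2.2.1
    · intro hf
      exact Subtype.ext (h.eq_of_notMem hx hs.1 f.2.1 hs.2.2.1 hf)

lemma card_label_inl (h : IsCentral H k c) (y : c) :
    Nat.card {x // h.label x = .inl y} = 1 := by
  simp [label_eq_inl]

lemma card_label_inr [Finite V] (h : IsCentral H k c) (f : {f // f ∈ H.edgeSet ∧ f ≠ c}) :
    Nat.card {x // h.label x = .inr f} = k - 1 := by
  simp only [label_eq_inr]
  have : (f.1 \ {(h.root f : V)}).ncard = k - 1 := by
    rw [Set.ncard_sdiff_singleton_of_mem (h.root_mem f), h.uniform f.1 f.2.1]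
  rw [← this, ← Nat.card_coe_set_eq]
  refine Nat.card_congr (Equiv.subtypeEquivRight fun x => ?_)
  simp only [Set.mem_sdiff, Set.mem_singleton_iff]
  refine ⟨fun hx => ⟨hx.2, fun e => hx.1 (e ▸ (h.root f).2)⟩, fun hx => ⟨fun hc => hx.2 ?_, hx.1⟩⟩
  exact h.eq_of_mem f.2.1 f.2.2 hc hx.1 (h.root f).2 (h.root_mem f)

lemma card_pend_fiber [Fintype V] (n : ℕ) :
    Nat.card {x : c // pend H c x = n} = (profile H c).count n := by
  classical
  rw [profile, Multiset.count_map, ← Finset.filter_val, Finset.card_val]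
  have e : {x : c // pend H c x = n} ≃ {x // x ∈ c.toFinset.filter fun a => n = pend H c a} :=
    ⟨fun x => ⟨x.1, by simp [x.2]⟩,
      fun x => ⟨⟨x.1, Set.mem_toFinset.1 (Finset.mem_filter.1 x.2).1⟩,
        (Finset.mem_filter.1 x.2).2.symm⟩, fun _ => rfl, fun _ => rfl⟩
  rw [Nat.card_congr e, Nat.card_eq_fintype_card, Fintype.card_coe]

/-- Three bijections, each lying over the one before: `σ` on the vertices of the central edges,
preserving the number of further edges; `ψ` on the further edges, respecting roots; `φ` on all
vertices, respecting labels. The fibres agree by the profile, by `σ`, and by uniformity. -/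
theorem iso [Fintype V] {W : Type v} [Fintype W] {G : Hypergraph W} {d : Set W}
    (h : IsCentral H k c) (h' : IsCentral G k d) (hp : profile H c = profile G d) : Iso H G := by
  obtain ⟨σ, hσ⟩ := exists_equiv_of_card_fiber (fun x : c => pend H c x)
    (fun x : d => pend G d x) (Equiv.refl ℕ) fun n => by
      rw [card_pend_fiber, Equiv.refl_apply, card_pend_fiber, hp]
  obtain ⟨ψ, hψ⟩ := exists_equiv_of_card_fiber h.root h'.root σ fun x => by
    rw [card_root_fiber, card_root_fiber]; exact (hσ x).symm
  obtain ⟨φ, hφ⟩ := exists_equiv_of_card_fiber h.label h'.label (Equiv.sumCongr σ ψ) fun i => by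
    rcases i with y | f
    · simp [card_label_inl]
    · simp [card_label_inr]
  have hφc : ∀ x (hx : x ∈ c), φ x = σ ⟨x, hx⟩ := fun x hx => by
    have h1 := hφ x
    rw [(h.label_eq_inl (y := ⟨x, hx⟩)).2 rfl] at h1
    exact h'.label_eq_inl.1 h1
  have hφf : ∀ x, x ∉ c → ∀ f, x ∈ f.1 → φ x ∈ (ψ f).1 := fun x hx f hf => by
    have h1 := hφ x
    rw [(h.label_eq_inr (f := f)).2 ⟨hx, hf⟩] at h1
    exact (h'.label_eq_inr.1 h1).2
  -- Both edges have `k` vertices, so inclusion of the image is enough.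
  have him : ∀ e ∈ H.edgeSet, ∀ e' ∈ G.edgeSet, (∀ x ∈ e, φ x ∈ e') → φ '' e = e' := by
    intro e he e' he' hee
    refine Set.eq_of_subset_of_ncard_le (Set.image_subset_iff.2 hee) ?_ (Set.toFinite _)
    rw [Set.ncard_image_of_injective _ φ.injective, h.uniform e he, h'.uniform e' he']
  have hc : φ '' c = d := him c h.mem d h'.mem fun x hx => by rw [hφc x hx]; exact (σ _).2
  have hf : ∀ f, φ '' f.1 = (ψ f).1 := fun f => him _ f.2.1 _ (ψ f).2.1 fun x hx => by
    by_cases hxc : x ∈ c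
    · rw [hφc x hxc, ← (h.root_eq_iff f ⟨x, hxc⟩).2 hx, ← hψ f]
      exact h'.root_mem _
    · exact hφf x hxc f hx
  refine ⟨φ, Hypergraph.ext ?_ ?_⟩
  · simp [h.vertexSet_eq, h'.vertexSet_eq]
  · ext e
    rw [Hypergraph.image_edgeSet]
    constructor
    · rintro ⟨f, hf', rfl⟩
      by_cases hfc : f = c
      · rw [hfc, hc]; exact h'.mem
      · rw [hf ⟨f, hf', hfc⟩]; exact (ψ _).2.1
    · intro he
      by_cases hed : e = d
      · exact ⟨c, h.mem, hc.trans hed.symm⟩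
      · refine ⟨(ψ.symm ⟨e, he, hed⟩).1, (ψ.symm ⟨e, he, hed⟩).2.1, ?_⟩
        rw [hf]; simp

end IsCentral

end

section

lemma pend_pos_iff {V : Type u} [Finite V] {H : Hypergraph V} {c : Set V} {x : V} :
    0 < pend H c x ↔ ∃ f ∈ H.edgeSet, f ≠ c ∧ x ∈ f := by
  rw [pend, Set.ncard_pos (Set.toFinite _)]
  exact ⟨fun ⟨f, h1, h2, h3⟩ => ⟨f, h1, h2, h3⟩, fun ⟨f, h1, h2, h3⟩ => ⟨f, h1, h2, h3⟩⟩

lemma IsCentral.memS_of_pend_pos {V : Type u} [Fintype V] {H : Hypergraph V} {k m : ℕ} {c : Set V}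
    (h : IsCentral H k c) (hk : 2 ≤ k) (hm : H.edgeSet.ncard = m) {x y : V} (hx : x ∈ c)
    (hy : y ∈ c) (hxy : x ≠ y) (hpx : 0 < pend H c x) (hpy : 0 < pend H c y) : MemS m 3 k H := by
  obtain ⟨f, hf, hfc, hxf⟩ := pend_pos_iff.1 hpx
  obtain ⟨g, hg, hgc, hyg⟩ := pend_pos_iff.1 hpy
  exact hm ▸ h.memS hk hx hy hxy hf hg hfc hgc hxf hyg

/-! ### The hypergraphs `attach m k a` with central edge number one -/

/-- The edge number `i` of `attach m k a`. -/
def attachEdge (m k : ℕ) (a : ℕ → ℕ) (i : ℕ) : Set (Fin (m * (k - 1) + 1)) :=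
  {x | x.val = a i ∨ (i * (k - 1) < x.val ∧ x.val ≤ (i + 1) * (k - 1))}

lemma mem_edgeSet_attach {m k : ℕ} {a : ℕ → ℕ} {e : Set (Fin (m * (k - 1) + 1))} :
    e ∈ (attach m k a).edgeSet ↔ ∃ i < m, e = attachEdge m k a i := Iff.rfl

/-- All edges but the first of `attach m k a` are attached at vertices of the edge number one, which
in turn is attached at the last vertex of the first edge. -/
structure IsStarlike (m k : ℕ) (a : ℕ → ℕ) : Prop where
  two_le_m : 2 ≤ m
  two_le_k : 2 ≤ k
  zero : a 0 = 0
  one : a 1 = k - 1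
  le : ∀ i, 2 ≤ i → i < m → k - 1 ≤ a i
  le' : ∀ i, 2 ≤ i → i < m → a i ≤ 2 * (k - 1)

namespace IsStarlike

variable {m k : ℕ} {a : ℕ → ℕ}

lemma mem_center (h : IsStarlike m k a) {x : Fin (m * (k - 1) + 1)} :
    x ∈ attachEdge m k a 1 ↔ k - 1 ≤ x.val ∧ x.val ≤ 2 * (k - 1) := by
  simp only [attachEdge, Set.mem_ofPred_eq, h.one]
  omega

/-- Edge `0` is the exception: it meets the centre in its last new vertex `k - 1`, not in its
attachment vertex `a 0 = 0`. -/
lemma mem_of_ne_one (h : IsStarlike m k a) {i : ℕ} (hi : i ≠ 1) (him : i < m)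
    {x : Fin (m * (k - 1) + 1)} :
    (x ∈ attachEdge m k a i ∧ x ∈ attachEdge m k a 1) ↔
      x.val = if i = 0 then k - 1 else a i := by
  have hk := h.two_le_k
  rw [h.mem_center]
  simp only [attachEdge, Set.mem_ofPred_eq]
  split_ifs with h0
  · subst h0
    rw [h.zero]
    omega
  · have h1 := h.le i (by omega) him
    have h2 := h.le' i (by omega) him
    have h3 : 2 * (k - 1) ≤ i * (k - 1) := Nat.mul_le_mul_right _ (by omega)
    omega

lemma a_le (h : IsStarlike m k a) {i : ℕ} (him : i < m) : a i ≤ 2 * (k - 1) := by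
  rcases Nat.lt_or_ge i 2 with hi | hi
  · interval_cases i
    · simp [h.zero]
    · rw [h.one]; omega
  · exact h.le' i hi him

lemma injOn (h : IsStarlike m k a) : Set.InjOn (attachEdge m k a) (Set.Iio m) := by
  have key : ∀ i j, i < j → j < m → attachEdge m k a i ≠ attachEdge m k a j := by
    intro i j hij hj he
    have hk := h.two_le_k
    have h1 : (j + 1) * (k - 1) ≤ m * (k - 1) := Nat.mul_le_mul_right _ (by omega)
    have h2 : (i + 1) * (k - 1) ≤ j * (k - 1) := Nat.mul_le_mul_right _ (by omega)
    have h3 : (j + 1) * (k - 1) = j * (k - 1) + (k - 1) := by ring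
    -- The last new vertex of the edge `j` lies beyond all new vertices of the edge `i`, so it could
    -- only be `a i`. This is at most `2 * (k - 1)`, which leaves `i = 0`, where `a 0 = 0`.
    have hx : (⟨(j + 1) * (k - 1), by omega⟩ : Fin (m * (k - 1) + 1)) ∈ attachEdge m k a j :=
      Or.inr ⟨by simp only; omega, le_rfl⟩
    rw [← he] at hx
    simp only [attachEdge, Set.mem_ofPred_eq] at hx
    have h4 : (j + 1) * (k - 1) = a i := by omega
    have h5 := h.a_le (hij.trans hj)
    have hi : i = 0 := by
      by_contra hi
      have : 3 * (k - 1) ≤ (j + 1) * (k - 1) := Nat.mul_le_mul_right _ (by omega)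
      omega
    rw [hi, h.zero] at h4
    omega
  intro i hi j hj he
  rcases lt_trichotomy i j with hij | hij | hij
  · exact absurd he (key i j hij hj)
  · exact hij
  · exact absurd he.symm (key j i hij hi)

lemma ncard_edgeSet (h : IsStarlike m k a) : (attach m k a).edgeSet.ncard = m := by
  have : (attach m k a).edgeSet = attachEdge m k a '' Set.Iio m := by
    ext e
    rw [mem_edgeSet_attach]
    exact ⟨fun ⟨i, hi, he⟩ => ⟨i, hi, he.symm⟩, fun ⟨i, hi, he⟩ => ⟨i, hi, he.symm⟩⟩
  rw [this, h.injOn.ncard_image, ← Finset.coe_Iio, Set.ncard_coe_finset]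
  simp

lemma ncard_edge (h : IsStarlike m k a) {i : ℕ} (him : i < m) :
    (attachEdge m k a i).ncard = k := by
  have hk := h.two_le_k
  have hm : 2 * (k - 1) ≤ m * (k - 1) := Nat.mul_le_mul_right _ h.two_le_m
  have h1 : (i + 1) * (k - 1) ≤ m * (k - 1) := Nat.mul_le_mul_right _ (by omega)
  have h3 : (i + 1) * (k - 1) = i * (k - 1) + (k - 1) := by ring
  have ha := h.a_le him
  rw [← Set.ncard_image_of_injective _ Fin.val_injective]
  have : Fin.val '' attachEdge m k a i =
      ((insert (a i) (Finset.Ioc (i * (k - 1)) ((i + 1) * (k - 1))) : Finset ℕ) : Set ℕ) := by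
    ext x
    simp only [attachEdge, Set.mem_image, Set.mem_ofPred_eq, Finset.coe_insert, Finset.coe_Ioc,
      Set.mem_insert_iff, Set.mem_Ioc]
    constructor
    · rintro ⟨y, hy, rfl⟩
      exact hy
    · intro hx
      exact ⟨⟨x, by omega⟩, hx, rfl⟩
  rw [this, Set.ncard_coe_finset, Finset.card_insert_of_notMem, Nat.card_Ioc]
  · omega
  · rw [Finset.mem_Ioc]
    rcases Nat.lt_or_ge i 2 with hi | hi
    · interval_cases i
      · simp [h.zero]
      · rw [h.one]; omega
    · have := Nat.mul_le_mul_right (k - 1) hi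
      omega

theorem isCentral (h : IsStarlike m k a) : IsCentral (attach m k a) k (attachEdge m k a 1) := by
  have hk := h.two_le_k
  have hm := h.two_le_m
  refine ⟨rfl, ?_, ⟨1, by omega, rfl⟩, ?_, ?_, ?_⟩
  · rintro e ⟨i, hi, rfl⟩
    exact h.ncard_edge hi
  · intro x
    rcases Nat.eq_zero_or_pos x.val with hx | hx
    · exact ⟨_, ⟨0, by omega, rfl⟩, Or.inl (hx.trans h.zero.symm)⟩
    -- The new vertices of the edge `i` form the block `(i (k - 1), (i + 1) (k - 1)]`, open on the
    -- left; hence the shift by one before dividing.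
    · refine ⟨_, ⟨(x.val - 1) / (k - 1), ?_, rfl⟩, Or.inr ⟨?_, ?_⟩⟩
      · rw [Nat.div_lt_iff_lt_mul (by omega)]
        have := x.2
        omega
      · have := Nat.div_mul_le_self (x.val - 1) (k - 1)
        omega
      · have := Nat.lt_div_mul_add (a := x.val - 1) (b := k - 1) (by omega)
        rw [add_mul]
        omega
  · rintro e ⟨i, hi, rfl⟩ he
    have hi1 : i ≠ 1 := by rintro rfl; exact he rfl
    have hm' : 2 * (k - 1) ≤ m * (k - 1) := Nat.mul_le_mul_right _ h.two_le_m
    have hb : (if i = 0 then k - 1 else a i) < m * (k - 1) + 1 := by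
      have := h.a_le hi
      split_ifs <;> omega
    refine ⟨⟨_, hb⟩, ?_⟩
    ext x
    rw [Set.mem_singleton_iff, Fin.ext_iff]
    exact h.mem_of_ne_one hi1 hi
  · have key : ∀ i j, i < j → j < m → i ≠ 1 → j ≠ 1 →
        attachEdge m k a i ∩ attachEdge m k a j ⊆ attachEdge m k a 1 := by
      rintro i j hij hj hi1 hj1 x ⟨hxi, hxj⟩
      have h2 : (i + 1) * (k - 1) ≤ j * (k - 1) := Nat.mul_le_mul_right _ (by omega)
      have h3 : 2 * (k - 1) ≤ j * (k - 1) := Nat.mul_le_mul_right _ (by omega)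
      have h4 := h.le j (by omega) hj
      have h4' := h.le' j (by omega) hj
      have h5 := h.a_le (hij.trans hj)
      rw [h.mem_center]
      simp only [attachEdge, Set.mem_ofPred_eq] at hxi hxj
      omega
    rintro e ⟨i, hi, rfl⟩ f ⟨j, hj, rfl⟩ he hf hef
    have hi1 : i ≠ 1 := by rintro rfl; exact he rfl
    have hj1 : j ≠ 1 := by rintro rfl; exact hf rfl
    rcases lt_trichotomy i j with hij | hij | hij
    · exact key i j hij hj hi1 hj1
    · exact absurd (by rw [hij]) hef
    · rw [Set.inter_comm]
      exact key j i hij hi hj1 hi1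

lemma pend_eq (h : IsStarlike m k a) {x : Fin (m * (k - 1) + 1)}
    (hx : x ∈ attachEdge m k a 1) :
    pend (attach m k a) (attachEdge m k a 1) x =
      ((Finset.range m).filter fun i =>
        i ≠ 1 ∧ x.val = if i = 0 then k - 1 else a i).card := by
  have hm := h.two_le_m
  have : {f | f ∈ (attach m k a).edgeSet ∧ f ≠ attachEdge m k a 1 ∧ x ∈ f} =
      attachEdge m k a '' (((Finset.range m).filter fun i =>
        i ≠ 1 ∧ x.val = if i = 0 then k - 1 else a i : Finset ℕ) : Set ℕ) := by
    ext f
    simp only [Set.mem_ofPred_eq, Set.mem_image, Finset.coe_filter, Finset.mem_range]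
    constructor
    · rintro ⟨⟨i, hi, rfl⟩, hf, hxf⟩
      have hi1 : i ≠ 1 := by rintro rfl; exact hf rfl
      exact ⟨i, ⟨hi, hi1, (h.mem_of_ne_one hi1 hi).1 ⟨hxf, hx⟩⟩, rfl⟩
    · rintro ⟨i, ⟨hi, hi1, hxi⟩, rfl⟩
      exact ⟨⟨i, hi, rfl⟩, fun e => hi1 (h.injOn hi (show 1 < m by omega) e),
        ((h.mem_of_ne_one hi1 hi).2 hxi).1⟩
  rw [pend, this, Set.InjOn.ncard_image, Set.ncard_coe_finset]
  refine h.injOn.mono fun i hi => ?_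
  simp only [Finset.coe_filter, Finset.mem_range, Set.mem_ofPred_eq] at hi
  exact hi.1

end IsStarlike

/-! ### The profiles of the extremal supertrees -/

lemma card_filter_eq {m n : ℕ} {p : ℕ → Prop} [DecidablePred p] (s : Finset ℕ)
    (h : ∀ i, (i < m ∧ p i) ↔ i ∈ s) (hs : s.card = n) :
    ((Finset.range m).filter p).card = n := by
  rw [← hs]
  congr 1
  ext i
  simpa using h i

/-- `H` is a supertree with `m` edges and diameter `3` whose central edge has the profile that
consists of `M` and zeros. -/
structure HasProfile {V : Type u} [Fintype V] (H : Hypergraph V) (m k : ℕ) (c : Set V)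
    (M : Multiset ℕ) : Prop where
  memS : MemS m 3 k H
  isCentral : IsCentral H k c
  profile_eq : profile H c = M + Multiset.replicate (k - M.card) 0

theorem exists_hasProfile_S₁ {m k : ℕ} (hk : 2 ≤ k) (hm : 4 ≤ m) :
    ∃ c, HasProfile (S₁ m 3 k) m k c {m - 2, 1} := by
  have h : IsStarlike m k fun i => if i < 3 then i * (k - 1) else 3 / 2 * (k - 1) := by
    refine ⟨by omega, hk, by simp, by simp, fun i h2 _ => ?_, fun i h2 _ => ?_⟩ <;>
    · have hi : i = 2 ∨ 3 ≤ i := by omega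
      rcases hi with rfl | hi
      · simp; try omega
      · rw [if_neg (by omega)]; omega
  have hm' : 2 * (k - 1) ≤ m * (k - 1) := Nat.mul_le_mul_right _ h.two_le_m
  set c := attachEdge m k _ 1
  -- These are `v₂`, carrying `e₁` and the `m - 3` attached edges, and `v₃`, carrying only `e₃`
  -- besides the centre.
  let x : Fin (m * (k - 1) + 1) := ⟨k - 1, by omega⟩
  let y : Fin (m * (k - 1) + 1) := ⟨2 * (k - 1), by omega⟩
  have hx : x ∈ c := h.mem_center.2 ⟨le_rfl, by simp only [x]; omega⟩
  have hy : y ∈ c := h.mem_center.2 ⟨by simp only [y]; omega, le_rfl⟩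
  have hxy : x ≠ y := by simp only [x, y, ne_eq, Fin.mk.injEq]; omega
  have px : pend (S₁ m 3 k) c x = m - 2 := by
    refine (h.pend_eq hx).trans (card_filter_eq ((Finset.range m \ {1, 2})) (fun i => ?_) ?_)
    · simp only [Finset.mem_sdiff, Finset.mem_range, Finset.mem_insert, Finset.mem_singleton, x]
      have hi : i = 0 ∨ i = 1 ∨ i = 2 ∨ 3 ≤ i := by omega
      rcases hi with rfl | rfl | rfl | hi
      · simp
      · simp
      · simp; omega
      · rw [if_neg (by omega), if_neg (by omega)]; omega
    · rw [Finset.card_sdiff_of_subset]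
      · simp
      · intro i hi; simp at hi ⊢; omega
  have py : pend (S₁ m 3 k) c y = 1 := by
    refine (h.pend_eq hy).trans (card_filter_eq {2} (fun i => ?_) (by simp))
    simp only [Finset.mem_singleton, y]
    have hi : i = 0 ∨ i = 1 ∨ i = 2 ∨ 3 ≤ i := by omega
    rcases hi with rfl | rfl | rfl | hi
    · simp; omega
    · simp
    · simp; omega
    · rw [if_neg (by omega), if_neg (by omega)]; omega
  refine ⟨c, h.isCentral.memS_of_pend_pos hk h.ncard_edgeSet hx hy hxy ?_ ?_, h.isCentral, ?_⟩
  · exact lt_of_lt_of_eq (by omega) px.symm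
  · exact lt_of_lt_of_eq (by omega) py.symm
  · have := h.isCentral.profile_eq {x, y} (by
      simp only [Finset.mem_insert, Finset.mem_singleton, forall_eq_or_imp, forall_eq]
      exact ⟨hx, hy⟩) (by
      rw [Finset.sum_pair hxy, h.ncard_edgeSet]
      exact (congrArg₂ (fun a b => a + b + 1) px py).trans (by omega))
    refine this.trans ?_
    rw [Finset.card_pair hxy]
    congr 1
    rw [Finset.insert_val_of_notMem (by simpa using hxy)]
    exact congrArg₂ (fun a b => ({a, b} : Multiset ℕ)) px py

theorem exists_hasProfile_S₄ {m k : ℕ} (hk : 2 ≤ k) (hm : 5 ≤ m) :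
    ∃ c, HasProfile (S₄ m k) m k c {m - 3, 2} := by
  have h : IsStarlike m k fun i =>
      if i < 3 then i * (k - 1) else if i < m - 1 then k - 1 else 2 * (k - 1) := by
    refine ⟨by omega, hk, by simp, by simp, fun i h2 _ => ?_, fun i h2 _ => ?_⟩ <;>
    · have hi : i = 2 ∨ 3 ≤ i := by omega
      rcases hi with rfl | hi
      · simp; try omega
      · rw [if_neg (by omega)]; split_ifs <;> omega
  have hm' : 2 * (k - 1) ≤ m * (k - 1) := Nat.mul_le_mul_right _ h.two_le_m
  set c := attachEdge m k _ 1
  -- Again `v₂` and `v₃`: `e₁` with `m - 4` attached edges at the former, `e₃` with one attached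
  -- edge at the latter.
  let x : Fin (m * (k - 1) + 1) := ⟨k - 1, by omega⟩
  let y : Fin (m * (k - 1) + 1) := ⟨2 * (k - 1), by omega⟩
  have hx : x ∈ c := h.mem_center.2 ⟨le_rfl, by simp only [x]; omega⟩
  have hy : y ∈ c := h.mem_center.2 ⟨by simp only [y]; omega, le_rfl⟩
  have hxy : x ≠ y := by simp only [x, y, ne_eq, Fin.mk.injEq]; omega
  have px : pend (S₄ m k) c x = m - 3 := by
    refine (h.pend_eq hx).trans (card_filter_eq ((Finset.range m \ {1, 2, m - 1})) (fun i => ?_) ?_)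
    · simp only [Finset.mem_sdiff, Finset.mem_range, Finset.mem_insert, Finset.mem_singleton, x]
      have hi : i = 0 ∨ i = 1 ∨ i = 2 ∨ 3 ≤ i := by omega
      rcases hi with rfl | rfl | rfl | hi
      · simp; omega
      · simp
      · simp; omega
      · rw [if_neg (by omega), if_neg (by omega)]; split_ifs <;> omega
    · rw [Finset.card_sdiff_of_subset]
      · rw [Finset.card_range, Finset.card_insert_of_notMem, Finset.card_pair] <;> simp <;> omega
      · intro i hi; simp at hi ⊢; omega
  have py : pend (S₄ m k) c y = 2 := by
    refine (h.pend_eq hy).trans (card_filter_eq {2, m - 1} (fun i => ?_)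
      (Finset.card_pair (by omega)))
    simp only [Finset.mem_singleton, Finset.mem_insert, y]
    have hi : i = 0 ∨ i = 1 ∨ i = 2 ∨ 3 ≤ i := by omega
    rcases hi with rfl | rfl | rfl | hi
    · simp; omega
    · simp; omega
    · simp; omega
    · rw [if_neg (by omega), if_neg (by omega)]; split_ifs <;> omega
  refine ⟨c, h.isCentral.memS_of_pend_pos hk h.ncard_edgeSet hx hy hxy ?_ ?_, h.isCentral, ?_⟩
  · exact lt_of_lt_of_eq (by omega) px.symm
  · exact lt_of_lt_of_eq (by omega) py.symm
  · have := h.isCentral.profile_eq {x, y} (by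
      simp only [Finset.mem_insert, Finset.mem_singleton, forall_eq_or_imp, forall_eq]
      exact ⟨hx, hy⟩) (by
      rw [Finset.sum_pair hxy, h.ncard_edgeSet]
      exact (congrArg₂ (fun a b => a + b + 1) px py).trans (by omega))
    refine this.trans ?_
    rw [Finset.card_pair hxy]
    congr 1
    rw [Finset.insert_val_of_notMem (by simpa using hxy)]
    exact congrArg₂ (fun a b => ({a, b} : Multiset ℕ)) px py

theorem exists_hasProfile_S₃ {k : ℕ} (hk : 3 ≤ k) :
    ∃ c, HasProfile (S₃ 4 3 k) 4 k c {1, 1, 1} := by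
  have h : IsStarlike 4 k fun i => if i < 3 then i * (k - 1) else 3 / 2 * (k - 1) + 1 := by
    refine ⟨by omega, by omega, by simp, by simp, fun i h2 h4 => ?_, fun i h2 h4 => ?_⟩ <;>
    · interval_cases i <;> simp <;> omega
  have hval : ∀ i, i < 4 → (i = 0 ∨ i = 1 ∨ i = 2 ∨ i = 3) := by omega
  set c := attachEdge 4 k _ 1
  let x : Fin (4 * (k - 1) + 1) := ⟨k - 1, by omega⟩
  let y : Fin (4 * (k - 1) + 1) := ⟨2 * (k - 1), by omega⟩
  -- The attachment vertex `(k - 1) + 1`; it differs from `2 * (k - 1)` because `k ≥ 3`.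
  let z : Fin (4 * (k - 1) + 1) := ⟨k, by omega⟩
  have hx : x ∈ c := h.mem_center.2 ⟨le_rfl, by simp only [x]; omega⟩
  have hy : y ∈ c := h.mem_center.2 ⟨by simp only [y]; omega, le_rfl⟩
  have hz : z ∈ c := h.mem_center.2 ⟨by simp only [z]; omega, by simp only [z]; omega⟩
  have hxy : x ≠ y := by simp only [x, y, ne_eq, Fin.mk.injEq]; omega
  have hxz : x ≠ z := by simp only [x, z, ne_eq, Fin.mk.injEq]; omega
  have hyz : y ≠ z := by simp only [y, z, ne_eq, Fin.mk.injEq]; omega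
  have px : pend (S₃ 4 3 k) c x = 1 := by
    refine (h.pend_eq hx).trans (card_filter_eq {0} (fun i => ?_) rfl)
    simp only [Finset.mem_singleton, x]
    refine ⟨fun ⟨h1, h2⟩ => ?_, fun h1 => by subst h1; simp⟩
    rcases hval i h1 with rfl | rfl | rfl | rfl <;> simp at h2 ⊢
    all_goals omega
  have py : pend (S₃ 4 3 k) c y = 1 := by
    refine (h.pend_eq hy).trans (card_filter_eq {2} (fun i => ?_) rfl)
    simp only [Finset.mem_singleton, y]
    refine ⟨fun ⟨h1, h2⟩ => ?_, fun h1 => by subst h1; simp⟩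
    rcases hval i h1 with rfl | rfl | rfl | rfl <;> simp at h2 ⊢
    all_goals omega
  have pz : pend (S₃ 4 3 k) c z = 1 := by
    refine (h.pend_eq hz).trans (card_filter_eq {3} (fun i => ?_) rfl)
    simp only [Finset.mem_singleton, z]
    refine ⟨fun ⟨h1, h2⟩ => ?_, fun h1 => by subst h1; simp; omega⟩
    rcases hval i h1 with rfl | rfl | rfl | rfl <;> simp at h2 ⊢
    all_goals omega
  refine ⟨c, h.isCentral.memS_of_pend_pos (by omega) h.ncard_edgeSet hx hy hxy ?_ ?_,
    h.isCentral, ?_⟩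
  · exact lt_of_lt_of_eq (by omega) px.symm
  · exact lt_of_lt_of_eq (by omega) py.symm
  · have hxn : x ∉ ({y, z} : Finset (Fin (4 * (k - 1) + 1))) := by simp [hxy, hxz]
    have := h.isCentral.profile_eq {x, y, z} (by
      simp only [Finset.mem_insert, Finset.mem_singleton, forall_eq_or_imp, forall_eq]
      exact ⟨hx, hy, hz⟩) (by
      rw [Finset.sum_insert hxn, Finset.sum_pair hyz, h.ncard_edgeSet]
      exact congrArg₂ (fun a b => a + b + 1) px (congrArg₂ (· + ·) py pz))
    refine this.trans ?_
    rw [Finset.card_insert_of_notMem hxn, Finset.card_pair hyz]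
    congr 1
    rw [Finset.insert_val_of_notMem hxn, Finset.insert_val_of_notMem (by simpa using hyz)]
    exact congrArg₂ (fun a b => a ::ₘ b) px (congrArg₂ (fun a b => ({a, b} : Multiset ℕ)) py pz)

end

/-! ### The eigenvalue equation and its positive solution. -/

section

namespace IsCentral

variable {V : Type u} {H : Hypergraph V} {k : ℕ} {c : Set V}

/-- The vector that is `z` on `c` and `z / t` on the remaining vertices of an edge attached at a
vertex with the value `z`. -/
def vec (h : IsCentral H k c) (t : ℝ) (z : V → ℝ) (v : V) : ℝ :=
  Sum.elim (fun x : c => z x) (fun f => z (h.root f) / t) (h.label v)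

lemma vec_of_mem (h : IsCentral H k c) {t : ℝ} {z : V → ℝ} {v : V} (hv : v ∈ c) :
    h.vec t z v = z v := by
  rw [vec, (h.label_eq_inl (y := ⟨v, hv⟩)).2 rfl]
  rfl

lemma vec_of_notMem (h : IsCentral H k c) {t : ℝ} {z : V → ℝ} {v : V} (hv : v ∉ c)
    (f : {f // f ∈ H.edgeSet ∧ f ≠ c}) (hvf : v ∈ f.1) : h.vec t z v = z (h.root f) / t := by
  rw [vec, (h.label_eq_inr (f := f)).2 ⟨hv, hvf⟩]
  rfl

end IsCentral

/-! ### The signless Laplacian of a uniform hypergraph as a form -/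

/-- These maps are the bijections onto `s`; their number cancels the factor `1 / (k - 1)!` of the
adjacency tensor. -/
lemma card_filter_image_eq {V : Type u} [Fintype V] [DecidableEq V] {n : ℕ} (s : Finset V)
    (hs : s.card = n) :
    (Finset.univ.filter fun f : Fin n → V => Finset.univ.image f = s).card = n.factorial := by
  have hinj : ∀ f : Fin n → V, Finset.univ.image f = s → Function.Injective f := fun f hf => by
    rw [← Set.injOn_univ, ← Finset.coe_univ]
    exact Finset.card_image_iff.1 (by rw [hf, hs, Finset.card_univ, Fintype.card_fin])
  have e : {f : Fin n → V // Finset.univ.image f = s} ≃ (Fin n ↪ s) :=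
    { toFun := fun f => ⟨fun j => ⟨f.1 j, by
            have := Finset.mem_image_of_mem f.1 (Finset.mem_univ j)
            rwa [f.2] at this⟩,
        fun i j hij => hinj f.1 f.2 (Subtype.ext_iff.1 hij)⟩
      invFun := fun g => ⟨fun j => g j, Finset.eq_of_subset_of_card_le
        (fun x hx => by
          obtain ⟨j, -, rfl⟩ := Finset.mem_image.1 hx
          exact (g j).2)
        (by
          rw [Finset.card_image_of_injective (f := fun j => (g j : V)) _
            (Subtype.val_injective.comp g.injective), Finset.card_univ, Fintype.card_fin, hs])⟩
      left_inv := fun _ => rfl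
      right_inv := fun _ => rfl }
  rw [← Fintype.card_subtype, Fintype.card_congr e, Fintype.card_embedding_eq, Fintype.card_coe,
    Fintype.card_fin, hs, Nat.descFactorial_self]

lemma sum_filter_image_eq {V : Type u} [Fintype V] [DecidableEq V] {n : ℕ} (s : Finset V)
    (hs : s.card = n) (x : V → ℂ) :
    ∑ f : Fin n → V, (if Finset.univ.image f = s then ∏ j, x (f j) else 0) =
      (n.factorial : ℂ) * ∏ v ∈ s, x v := by
  rw [← Finset.sum_filter, ← card_filter_image_eq s hs, ← nsmul_eq_mul, ← Finset.sum_const]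
  refine Finset.sum_congr rfl fun f hf => ?_
  have hf' := (Finset.mem_filter.1 hf).2
  have hinj : Set.InjOn f (Finset.univ : Finset (Fin n)) :=
    Finset.card_image_iff.1 (by rw [hf', hs, Finset.card_univ, Fintype.card_fin])
  rw [← hf', Finset.prod_image hinj]

variable {V : Type u} [Fintype V] {H : Hypergraph V} {k : ℕ}

open Classical in
/-- The finite set of the edges that contain a vertex. -/
def edgesAt (H : Hypergraph V) (i : V) : Finset (Set V) :=
  Finset.univ.filter fun e => e ∈ H.edgeSet ∧ i ∈ e

lemma mem_edgesAt {i : V} {e : Set V} : e ∈ edgesAt H i ↔ e ∈ H.edgeSet ∧ i ∈ e := by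
  simp [edgesAt]

open Classical in
/-- The form `x ↦ Q x ^ (k - 1)` of the signless Laplacian of a `k`-uniform hypergraph. -/
def form {R : Type*} [CommSemiring R] (H : Hypergraph V) (k : ℕ) (x : V → R) (i : V) : R :=
  degree H i * x i ^ (k - 1) + ∑ e ∈ edgesAt H i, ∏ j ∈ e.toFinset.erase i, x j

open Classical in
lemma IsUniform.card_erase (hu : IsUniform H k) {e : Set V} {i : V} (he : e ∈ H.edgeSet)
    (hi : i ∈ e) : (e.toFinset.erase i).card = k - 1 := by
  rw [Finset.card_erase_of_mem (by simpa using hi), ← Set.ncard_eq_toFinset_card', hu e he]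

open Classical in
-- An edge has `k` elements, so the `k - 1` values of `f` must fill `e` without `i`, with no room
-- for repetitions.
lemma insert_range_eq_iff (hu : IsUniform H k) {e : Set V} {i : V} (he : e ∈ H.edgeSet)
    (hi : i ∈ e) (f : Fin (k - 1) → V) :
    insert i (Set.range f) = e ↔ Finset.univ.image f = e.toFinset.erase i := by
  constructor
  · intro h
    symm
    apply Finset.eq_of_subset_of_card_le
    · intro x hx
      rw [Finset.mem_erase, Set.mem_toFinset, ← h, Set.mem_insert_iff] at hx
      obtain ⟨j, hj⟩ := hx.2.resolve_left hx.1
      exact hj ▸ Finset.mem_image_of_mem _ (Finset.mem_univ j)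
    · rw [hu.card_erase he hi]
      exact Finset.card_image_le.trans (by simp)
  · intro h
    have h2 := congrArg (fun s : Finset V => (s : Set V)) h
    simp only [Finset.coe_image, Finset.coe_univ, Set.image_univ, Finset.coe_erase,
      Set.coe_toFinset] at h2
    rw [h2, Set.insert_sdiff_singleton, Set.insert_eq_of_mem hi]

theorem app_signlessLaplacian (hu : IsUniform H k) (x : V → ℂ) (i : V) :
    (signlessLaplacian H k).app x i = form H k x i := by
  classical
  simp only [Tensor.app, signlessLaplacian, Pi.add_apply, add_mul, Finset.sum_add_distrib, form]
  congr 1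
  · rw [Finset.sum_eq_single fun _ => i]
    · simp [degTensor]
    · intro f _ hf
      have : ¬ ∀ j, f j = i := fun h => hf (funext h)
      simp [degTensor, this]
    · simp
  · have h1 : ∀ f : Fin (k - 1) → V, adjTensor H k i f * ∏ j, x (f j) =
        ∑ e ∈ edgesAt H i, (if Finset.univ.image f = e.toFinset.erase i then ∏ j, x (f j) else 0) *
          (1 / (Nat.factorial (k - 1) : ℂ)) := by
      intro f
      have h2 : ∀ e ∈ edgesAt H i,
          (if Finset.univ.image f = e.toFinset.erase i then ∏ j, x (f j) else 0) *
            (1 / (Nat.factorial (k - 1) : ℂ)) =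
          if insert i (Set.range f) = e then
            (∏ j, x (f j)) * (1 / (Nat.factorial (k - 1) : ℂ)) else 0 := by
        intro e he
        have he' := mem_edgesAt.1 he
        by_cases h : insert i (Set.range f) = e
        · rw [if_pos h, if_pos ((insert_range_eq_iff hu he'.1 he'.2 f).1 h)]
        · rw [if_neg h, if_neg fun h' => h ((insert_range_eq_iff hu he'.1 he'.2 f).2 h'), zero_mul]
      rw [Finset.sum_congr rfl h2, Finset.sum_ite_eq]
      simp only [adjTensor, mem_edgesAt, Set.mem_insert_iff, true_or, and_true]
      split_ifs
      · ring
      · simp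
    rw [Finset.sum_congr rfl fun f _ => h1 f, Finset.sum_comm]
    refine Finset.sum_congr rfl fun e he => ?_
    have he' := mem_edgesAt.1 he
    rw [← Finset.sum_mul, sum_filter_image_eq _ (hu.card_erase he'.1 he'.2)]
    have : (Nat.factorial (k - 1) : ℂ) ≠ 0 := by exact_mod_cast Nat.factorial_ne_zero _
    field_simp

lemma norm_form_le (x : V → ℂ) (i : V) : ‖form H k x i‖ ≤ form H k (fun j => ‖x j‖) i := by
  unfold form
  refine (norm_add_le _ _).trans (add_le_add ?_ ((norm_sum_le _ _).trans ?_))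
  · simp
  · exact Finset.sum_le_sum fun e _ => by simp

lemma form_ofReal (y : V → ℝ) (i : V) :
    form H k (fun j => (y j : ℂ)) i = ((form H k y i : ℝ) : ℂ) := by
  simp [form]

lemma form_mono {x y : V → ℝ} (hx : ∀ i, 0 ≤ x i) (hxy : ∀ i, x i ≤ y i) (i : V) :
    form H k x i ≤ form H k y i := by
  unfold form
  refine add_le_add ?_ (Finset.sum_le_sum fun e _ => ?_)
  · exact mul_le_mul_of_nonneg_left (pow_le_pow_left₀ (hx i) (hxy i) _) (Nat.cast_nonneg _)
  · exact Finset.prod_le_prod (fun j _ => hx j) fun j _ => hxy j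

lemma form_smul (hu : IsUniform H k) (r : ℝ) (y : V → ℝ) (i : V) :
    form H k (fun j => r * y j) i = r ^ (k - 1) * form H k y i := by
  classical
  unfold form
  rw [mul_add, Finset.mul_sum]
  congr 1
  · ring
  · refine Finset.sum_congr rfl fun e he => ?_
    have he' := mem_edgesAt.1 he
    rw [Finset.prod_mul_distrib, Finset.prod_const]
    congr 2
    convert hu.card_erase he'.1 he'.2

/-- An eigenvalue with a positive eigenvector is the spectral radius. -/
theorem q_eq_of_pos_eigenvector [Nonempty V] (hu : IsUniform H k) {y : V → ℝ} (hy : ∀ i, 0 < y i)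
    {l : ℝ} (h : ∀ i, form H k y i = l * y i ^ (k - 1)) : q k H = l := by
  have hl : 0 ≤ l := by
    obtain ⟨i⟩ := ‹Nonempty V›
    have h1 : 0 ≤ form H k y i := add_nonneg
      (mul_nonneg (Nat.cast_nonneg _) (pow_nonneg (hy i).le _))
      (Finset.sum_nonneg fun e _ => Finset.prod_nonneg fun j _ => (hy j).le)
    rw [h i] at h1
    exact nonneg_of_mul_nonneg_left h1 (pow_pos (hy i) _)
  refine IsGreatest.csSup_eq ⟨⟨(l : ℂ), ⟨fun i => (y i : ℂ), ?_, fun i => ?_⟩, ?_⟩, ?_⟩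
  · obtain ⟨i⟩ := ‹Nonempty V›
    intro h0
    have := congrFun h0 i
    simp at this
    exact (hy i).ne' this
  · rw [app_signlessLaplacian hu, form_ofReal, h i]
    push_cast
    rfl
  · simp [abs_of_nonneg hl]
  · rintro _ ⟨μ, ⟨x, hx0, hx⟩, rfl⟩
    -- The smallest multiple `r * y` dominating `‖x‖` touches it at `i`. Monotonicity of the form,
    -- evaluated at `i`, gives `‖μ‖ ≤ l`.
    obtain ⟨i, hi⟩ := Finite.exists_max fun j => ‖x j‖ / y j
    set r := ‖x i‖ / y i with hr
    have hle : ∀ j, ‖x j‖ ≤ r * y j := fun j => (div_le_iff₀ (hy j)).1 (hi j)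
    have hr0 : 0 < r := by
      obtain ⟨j, hj⟩ := Function.ne_iff.1 hx0
      exact lt_of_lt_of_le (div_pos (norm_pos_iff.2 hj) (hy j)) (hi j)
    have hxi : ‖x i‖ = r * y i := by rw [hr, div_mul_cancel₀ _ (hy i).ne']
    have h1 : ‖μ‖ * ‖x i‖ ^ (k - 1) ≤ r ^ (k - 1) * (l * y i ^ (k - 1)) := by
      rw [← norm_pow, ← norm_mul, ← hx i, app_signlessLaplacian hu, ← h i, ← form_smul hu]
      exact (norm_form_le x i).trans (form_mono (fun _ => norm_nonneg _) hle i)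
    rw [hxi, mul_pow] at h1
    have h2 : 0 < r ^ (k - 1) * y i ^ (k - 1) := mul_pos (pow_pos hr0 _) (pow_pos (hy i) _)
    exact le_of_mul_le_mul_right (by linarith) h2

/-! ### The spectral radius of a hypergraph with a central edge -/

/-- The factor of the characteristic equation that belongs to a vertex with `n` further edges. -/
def fac (k : ℕ) (t : ℝ) (n : ℕ) : ℝ := t - n * (1 + 1 / t ^ (k - 1))

/-- `t` solves the characteristic equation of the profile `M`, and all factors are positive. -/
structure IsMainRoot (k : ℕ) (M : Multiset ℕ) (t : ℝ) : Prop where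
  pos : 0 < t
  fac_pos : ∀ n ∈ M, 0 < fac k t n
  prod_eq_one : (M.map (fac k t)).prod = 1

variable {c : Set V}

namespace IsCentral

open Classical in
lemma form_vec_of_mem (h : IsCentral H k c) {t : ℝ} {z : V → ℝ} {v : V} (hv : v ∈ c) :
    form H k (h.vec t z) v = (pend H c v + 1) * z v ^ (k - 1) +
      ((∏ j ∈ c.toFinset.erase v, z j) + pend H c v * (z v / t) ^ (k - 1)) := by
  rw [form, h.degree_of_mem hv, h.vec_of_mem hv]
  push_cast
  congr 1
  have hc : c ∈ edgesAt H v := mem_edgesAt.2 ⟨h.mem, hv⟩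
  rw [← Finset.add_sum_erase _ _ hc]
  congr 1
  · exact Finset.prod_congr rfl fun j hj =>
      h.vec_of_mem (Set.mem_toFinset.1 (Finset.mem_of_mem_erase hj))
  · have hcard : ((edgesAt H v).erase c).card = pend H c v := by
      rw [pend, Set.ncard_eq_toFinset_card']
      congr 1
      ext e
      simp only [Finset.mem_erase, mem_edgesAt, Set.mem_toFinset, Set.mem_ofPred_eq]
      tauto
    rw [← hcard, ← nsmul_eq_mul, ← Finset.sum_const]
    refine Finset.sum_congr rfl fun e he => ?_
    obtain ⟨hec, he⟩ := Finset.mem_erase.1 he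
    obtain ⟨heE, hve⟩ := mem_edgesAt.1 he
    have hroot : h.root ⟨e, heE, hec⟩ = ⟨v, hv⟩ := (h.root_eq_iff _ _).2 hve
    rw [← h.uniform.card_erase heE hve, ← Finset.prod_const]
    refine Finset.prod_congr rfl fun j hj => ?_
    obtain ⟨hjv, hj⟩ := Finset.mem_erase.1 hj
    rw [Set.mem_toFinset] at hj
    have hjc : j ∉ c := fun hjc => hjv (h.eq_of_mem heE hec hjc hj hv hve)
    rw [h.vec_of_notMem hjc ⟨e, heE, hec⟩ hj, hroot]

/-- In an attached edge the root has `t` times the common value `w` of the new vertices, so the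
product of the others is `t * w ^ (k - 1)`; the degree contributes the `1`. -/
lemma form_vec_of_notMem (h : IsCentral H k c) (hk : 2 ≤ k) {t : ℝ} (ht : t ≠ 0) {z : V → ℝ}
    {v : V} (hv : v ∉ c) : form H k (h.vec t z) v = (1 + t) * h.vec t z v ^ (k - 1) := by
  classical
  obtain ⟨f, hf, hfc, hvf, -⟩ := h.exists_edge hv
  obtain ⟨r, hr⟩ : ∃ r : V, (h.root ⟨f, hf, hfc⟩ : V) = r := ⟨_, rfl⟩
  have hrc : r ∈ c := hr ▸ (h.root ⟨f, hf, hfc⟩).2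
  have hrf : r ∈ f := hr ▸ h.root_mem ⟨f, hf, hfc⟩
  have hvec : ∀ j ∈ f, j ∉ c → h.vec t z j = z r / t := fun j hj hjc =>
    hr ▸ h.vec_of_notMem hjc ⟨f, hf, hfc⟩ hj
  have hE : edgesAt H v = {f} := by
    ext e
    rw [mem_edgesAt, Finset.mem_singleton]
    exact ⟨fun he => h.eq_of_notMem hv he.1 hf he.2 hvf, fun he => he ▸ ⟨hf, hvf⟩⟩
  have hr' : r ∈ f.toFinset.erase v :=
    Finset.mem_erase.2 ⟨fun e => hv (e ▸ hrc), Set.mem_toFinset.2 hrf⟩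
  rw [form, hE, Finset.sum_singleton, h.degree_of_notMem hv, hvec v hvf hv,
    ← Finset.mul_prod_erase _ _ hr', h.vec_of_mem hrc,
    Finset.prod_congr rfl (g := fun _ => z r / t), Finset.prod_const,
    Finset.card_erase_of_mem hr', h.uniform.card_erase hf hvf]
  · obtain ⟨k, rfl⟩ := Nat.exists_eq_add_of_le' hk
    rw [show k + 2 - 1 = k + 1 by omega, show k + 1 - 1 = k by omega, pow_succ]
    have : z r = t * (z r / t) := by field_simp
    push_cast
    linear_combination (z r / t) ^ k * this
  · intro j hj
    obtain ⟨hjr, hj⟩ := Finset.mem_erase.1 hj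
    have hjf := Set.mem_toFinset.1 (Finset.mem_of_mem_erase hj)
    exact hvec j hjf fun hjc => hjr (h.eq_of_mem hf hfc hjc hjf hrc hrf)

/-- The equations on `c` ask for `z v ^ k * fac = ∏ z`; the values with `z v ^ k * fac = 1` have `∏
z = 1` because the factors multiply to one. -/
theorem q_eq (h : IsCentral H k c) (hk : 2 ≤ k) {t : ℝ} (ht : IsMainRoot k (profile H c) t) :
    q k H = 1 + t := by
  classical
  have hk0 : (k : ℝ) ≠ 0 := by positivity
  have hfac : ∀ v ∈ c, 0 < fac k t (pend H c v) := fun v hv =>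
    ht.fac_pos _ (Multiset.mem_map_of_mem _ (Set.mem_toFinset.2 hv))
  have hprod : ∏ v ∈ c.toFinset, fac k t (pend H c v) = 1 := by
    have := ht.prod_eq_one
    rwa [profile, Multiset.map_map] at this
  obtain ⟨z, hz⟩ : ∃ z : V → ℝ, ∀ v ∈ c, 0 < z v ∧ z v ^ k * fac k t (pend H c v) = 1 := by
    refine ⟨fun v => fac k t (pend H c v) ^ (-(k : ℝ)⁻¹), fun v hv => ?_⟩
    refine ⟨Real.rpow_pos_of_pos (hfac v hv) _, ?_⟩
    rw [← Real.rpow_natCast, ← Real.rpow_mul (hfac v hv).le, neg_mul, inv_mul_cancel₀ hk0,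
      Real.rpow_neg_one, inv_mul_cancel₀ (hfac v hv).ne']
  have hzprod : ∏ v ∈ c.toFinset, z v = 1 := by
    have h1 : (∏ v ∈ c.toFinset, z v) ^ k = 1 := by
      rw [← Finset.prod_pow, ← mul_one (∏ v ∈ c.toFinset, z v ^ k), ← hprod,
        ← Finset.prod_mul_distrib, hprod]
      exact Finset.prod_eq_one fun v hv => (hz v (Set.mem_toFinset.1 hv)).2
    exact (pow_eq_one_iff_of_nonneg
      (Finset.prod_nonneg fun v hv => (hz v (Set.mem_toFinset.1 hv)).1.le) (by omega)).1 h1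
  have hne : Nonempty V := by
    obtain ⟨v, -⟩ := (h.isConnected (by omega)).1
    exact ⟨v⟩
  refine q_eq_of_pos_eigenvector h.uniform (y := h.vec t z) (fun v => ?_) fun v => ?_
  · by_cases hv : v ∈ c
    · rw [h.vec_of_mem hv]
      exact (hz v hv).1
    · obtain ⟨f, hf, hfc, hvf, -⟩ := h.exists_edge hv
      rw [h.vec_of_notMem hv ⟨f, hf, hfc⟩ hvf]
      exact div_pos (hz _ (h.root _).2).1 ht.pos
  · by_cases hv : v ∈ c
    · rw [h.form_vec_of_mem hv, h.vec_of_mem hv]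
      obtain ⟨hz0, hzk⟩ := hz v hv
      have h1 : z v * ∏ j ∈ c.toFinset.erase v, z j = 1 := by
        rw [Finset.mul_prod_erase _ _ (Set.mem_toFinset.2 hv), hzprod]
      have h2 : ∏ j ∈ c.toFinset.erase v, z j = z v ^ (k - 1) * fac k t (pend H c v) := by
        apply mul_left_cancel₀ hz0.ne'
        rw [h1, ← hzk, ← mul_assoc, ← pow_succ', Nat.sub_add_cancel (by omega)]
      rw [h2, fac, div_pow]
      ring
    · exact h.form_vec_of_notMem hk ht.pos.ne' hv

end IsCentral

end

section

/-! ### The characteristic equation -/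

lemma one_le_prod_map {ι : Type*} {f : ι → ℝ} {M : Multiset ι} (h : ∀ n ∈ M, 1 ≤ f n) :
    1 ≤ (M.map f).prod := by
  induction M using Multiset.induction with
  | empty => simp
  | cons a M ih =>
    rw [Multiset.map_cons, Multiset.prod_cons]
    exact one_le_mul_of_one_le_of_one_le (h a (Multiset.mem_cons_self a M))
      (ih fun n hn => h n (Multiset.mem_cons_of_mem hn))

lemma fac_mono {k n : ℕ} {s t : ℝ} (hs : 0 < s) (hst : s ≤ t) : fac k s n ≤ fac k t n := by
  unfold fac
  gcongr

lemma exists_isMainRoot {k : ℕ} {M : Multiset ℕ} (hM : ∃ n ∈ M, 0 < n) :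
    ∃ t, IsMainRoot k M t := by
  -- The truncation at `1` keeps `g` continuous. The truncation at `0` makes `g 1` vanish, since a
  -- positive `n` gives the factor `1 - 2 n < 0`. Where `g = 1`, no factor has been truncated to
  -- `0`.
  let g : ℝ → ℝ := fun t => (M.map fun n => max 0 (fac k (max 1 t) n)).prod
  have hg : Continuous g := by
    refine continuous_multiset_prod M fun n _ => ?_
    unfold fac
    have : ∀ t : ℝ, (max 1 t) ^ (k - 1) ≠ 0 := fun t => by positivity
    fun_prop (disch := assumption)
  have h1 : g 1 = 0 := by
    obtain ⟨n, hn, hn0⟩ := hM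
    apply Multiset.prod_eq_zero
    rw [Multiset.mem_map]
    refine ⟨n, hn, ?_⟩
    have : (1 : ℝ) ≤ n := by exact_mod_cast hn0
    apply max_eq_left
    simp only [fac, max_self, one_pow]
    linarith
  have hb : (1 : ℝ) ≤ 2 * (M.sum : ℝ) + 1 := by
    have : (0 : ℝ) ≤ (M.sum : ℝ) := Nat.cast_nonneg _
    linarith
  -- For `t ≥ 1` each factor is at least `t - 2 n`, so at `t = 2 * M.sum + 1` it is at least `1`.
  have h2 : 1 ≤ g (2 * (M.sum : ℝ) + 1) := by
    refine one_le_prod_map fun n hn => le_max_of_le_right ?_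
    rw [max_eq_right hb, fac]
    have h3 : (n : ℝ) ≤ M.sum := by
      exact_mod_cast Multiset.single_le_sum (fun _ _ => Nat.zero_le _) n hn
    have h4 : 1 / (2 * (M.sum : ℝ) + 1) ^ (k - 1) ≤ 1 := by
      rw [div_le_one (by positivity)]
      exact one_le_pow₀ hb
    have h5 : (n : ℝ) * (1 + 1 / (2 * (M.sum : ℝ) + 1) ^ (k - 1)) ≤ M.sum * 2 := by
      gcongr
      linarith
    linarith
  obtain ⟨t, ⟨ht1, -⟩, ht⟩ := intermediate_value_Icc hb hg.continuousOn
    (show (1 : ℝ) ∈ Set.Icc (g 1) (g (2 * (M.sum : ℝ) + 1)) from ⟨by rw [h1]; exact zero_le_one, h2⟩)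
  have hpos : ∀ n ∈ M, 0 < fac k t n := by
    intro n hn
    by_contra hle
    have h0 : g t = 0 := by
      apply Multiset.prod_eq_zero
      rw [Multiset.mem_map]
      exact ⟨n, hn, max_eq_left (by rw [max_eq_right ht1]; linarith)⟩
    rw [h0] at ht
    exact zero_ne_one ht
  refine ⟨t, by linarith, hpos, ?_⟩
  rw [← ht]
  refine congrArg Multiset.prod (Multiset.map_congr rfl fun n hn => ?_)
  rw [max_eq_right ht1, max_eq_right (hpos n hn).le]

/-- Taking out `t` lets the profile enter only through `1 - n r` with one parameter `r` common to
all entries. -/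
lemma fac_eq {k n : ℕ} {t : ℝ} (ht : 0 < t) :
    fac k t n = t * (1 - n * ((1 + 1 / t ^ (k - 1)) / t)) := by
  unfold fac
  field_simp

lemma prod_fac_eq {k : ℕ} {t : ℝ} (ht : 0 < t) (M : Multiset ℕ) :
    (M.map (fac k t)).prod =
      t ^ M.card * (M.map fun n : ℕ => 1 - n * ((1 + 1 / t ^ (k - 1)) / t)).prod := by
  rw [Multiset.map_congr rfl fun n _ => fac_eq (k := k) (n := n) ht, Multiset.prod_map_mul,
    Multiset.map_const', Multiset.prod_replicate]

/-- Comparison of the roots of two characteristic equations. -/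
lemma IsMainRoot.lt_of_prod_lt {k : ℕ} {M N : Multiset ℕ} {s t : ℝ} (hM : IsMainRoot k M s)
    (hN : IsMainRoot k N t) (hcard : M.card = N.card)
    (h : ∀ r : ℝ, 0 < r → (∀ n ∈ N, 0 < 1 - n * r) → (∀ n ∈ M, 0 < 1 - n * r) ∧
      (N.map fun n : ℕ => 1 - n * r).prod < (M.map fun n : ℕ => 1 - n * r).prod) : s < t := by
  have ht := hN.pos
  obtain ⟨h1, h2⟩ := h ((1 + 1 / t ^ (k - 1)) / t) (by positivity) fun n hn => by
    have := hN.fac_pos n hn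
    rw [fac_eq ht] at this
    exact pos_of_mul_pos_right this ht.le
  -- At `t` the product for `N` is one, so the product for `M` exceeds one with all factors
  -- positive. If `t ≤ s`, it would still exceed one at `s`.
  by_contra hle
  have hle := not_lt.1 hle
  have h3 : (M.map (fac k t)).prod ≤ (M.map (fac k s)).prod :=
    Multiset.prod_map_le_prod_map₀ _ _
      (fun n hn => by rw [fac_eq ht]; exact (mul_pos ht (h1 n hn)).le)
      fun n _ => fac_mono ht hle
  rw [hM.prod_eq_one, ← hN.prod_eq_one, prod_fac_eq ht, prod_fac_eq ht, hcard] at h3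
  exact absurd h2 (not_lt.2 (le_of_mul_le_mul_left h3 (pow_pos ht _)))

/-! ### Weierstrass product inequalities -/

lemma one_sub_sum_le_prod {r : ℝ} (hr : 0 ≤ r) (M : Multiset ℕ) (h : (M.sum : ℝ) * r ≤ 1) :
    1 - M.sum * r ≤ (M.map fun n : ℕ => 1 - n * r).prod := by
  induction M using Multiset.induction with
  | empty => simp
  | cons a M ih =>
    rw [Multiset.map_cons, Multiset.prod_cons]
    rw [Multiset.sum_cons, Nat.cast_add] at h ⊢
    have ha : 0 ≤ (a : ℝ) * r := by positivity
    have hs : 0 ≤ (M.sum : ℝ) * r := by positivity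
    have h1 := ih (by linarith)
    have h2 : 0 ≤ 1 - (a : ℝ) * r := by linarith
    nlinarith [mul_le_mul_of_nonneg_left h1 h2, mul_nonneg ha hs]

lemma one_sub_sum_lt_prod {r : ℝ} (hr : 0 < r) {a : ℕ} {M : Multiset ℕ} (ha : 0 < a)
    (hM : 0 < M.sum) (h : ((a + M.sum : ℕ) : ℝ) * r ≤ 1) :
    1 - ((a + M.sum : ℕ) : ℝ) * r < ((a ::ₘ M).map fun n : ℕ => 1 - n * r).prod := by
  rw [Multiset.map_cons, Multiset.prod_cons]
  rw [Nat.cast_add] at h ⊢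
  have ha' : 0 < (a : ℝ) * r := mul_pos (Nat.cast_pos.2 ha) hr
  have hs : 0 < (M.sum : ℝ) * r := mul_pos (Nat.cast_pos.2 hM) hr
  have h1 := one_sub_sum_le_prod hr.le M (by linarith)
  have h2 : 0 ≤ 1 - (a : ℝ) * r := by linarith
  nlinarith [mul_le_mul_of_nonneg_left h1 h2, mul_pos ha' hs]

/-- Among the multisets of positive numbers with sum `a + 2`, other than `{a + 2}`, `{a + 1, 1}` and
`{a, 2}`, none gives a product as small as `{a, 2}`. -/
theorem prod_lt_prod_of_ne {a : ℕ} (ha : 2 ≤ a) {r : ℝ} (hr : 0 < r) (har : (a : ℝ) * r < 1)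
    {P : Multiset ℕ} (hpos : ∀ n ∈ P, 0 < n) (hsum : P.sum = a + 2) (h0 : P ≠ {a + 2})
    (h1 : P ≠ {a + 1, 1}) (h2 : P ≠ {a, 2}) :
    (∀ n ∈ P, 0 < 1 - (n : ℝ) * r) ∧
      (1 - a * r) * (1 - 2 * r) < (P.map fun n : ℕ => 1 - n * r).prod := by
  have ha' : (2 : ℝ) ≤ a := by exact_mod_cast ha
  have h2r : 2 * r < 1 := by nlinarith
  -- A part larger than `a` leaves at most `1` for the rest, which gives `{a + 2}` or `{a + 1, 1}`.
  have hle : ∀ n ∈ P, n ≤ a := by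
    intro n hn
    by_contra hna
    obtain ⟨R, rfl⟩ := Multiset.exists_cons_of_mem hn
    rw [Multiset.sum_cons] at hsum
    have hR : R.sum ≤ 1 := by omega
    rcases Multiset.empty_or_exists_mem R with rfl | ⟨b, hb⟩
    · simp only [Multiset.sum_zero, add_zero] at hsum
      exact h0 (by rw [hsum]; rfl)
    · obtain ⟨R, rfl⟩ := Multiset.exists_cons_of_mem hb
      have hb0 := hpos b (by simp)
      rw [Multiset.sum_cons] at hsum hR
      rcases Multiset.empty_or_exists_mem R with rfl | ⟨d, hd⟩
      · simp only [Multiset.sum_zero, add_zero] at hsum hR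
        have e1 : b = 1 := by omega
        have e2 : n = a + 1 := by omega
        subst e1 e2
        exact h1 rfl
      · have := hpos d (by simp [hd])
        have := Multiset.single_le_sum (fun _ _ => Nat.zero_le _) d hd
        omega
  refine ⟨fun n hn => ?_, ?_⟩
  · have : (n : ℝ) ≤ a := by exact_mod_cast hle n hn
    nlinarith
  by_cases hex : ∃ n ∈ P, 2 ≤ n
  · obtain ⟨n, hn, hn2⟩ := hex
    have hna := hle n hn
    obtain ⟨R, rfl⟩ := Multiset.exists_cons_of_mem hn
    rw [Multiset.sum_cons] at hsum
    rw [Multiset.map_cons, Multiset.prod_cons]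
    have hnr : (n : ℝ) * r < 1 := by
      have : (n : ℝ) ≤ a := by exact_mod_cast hna
      nlinarith
    have hRr : (R.sum : ℝ) * r < 1 := by
      have : (R.sum : ℝ) ≤ a := by exact_mod_cast (show R.sum ≤ a by omega)
      nlinarith
    have hsum' : (n : ℝ) + R.sum = a + 2 := by exact_mod_cast hsum
    have hn2' : (2 : ℝ) ≤ n := by exact_mod_cast hn2
    have hna' : (n : ℝ) ≤ a := by exact_mod_cast hna
    -- The rest `R` is merged into one part `a + 2 - n`; the difference of the two sides is `(n - 2)
    -- (a - n) r ^ 2`.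
    have hpair : (1 - a * r) * (1 - 2 * r) ≤ (1 - n * r) * (1 - R.sum * r) := by
      have : (R.sum : ℝ) = a + 2 - n := by linarith
      rw [this]
      nlinarith [mul_nonneg (mul_nonneg (sub_nonneg.2 hn2') (sub_nonneg.2 hna')) (sq_nonneg r)]
    by_cases hstrict : 2 < n ∧ n < a
    · have h3 : (2 : ℝ) < n := by exact_mod_cast hstrict.1
      have h4 : (n : ℝ) < a := by exact_mod_cast hstrict.2
      have hpair : (1 - a * r) * (1 - 2 * r) < (1 - n * r) * (1 - R.sum * r) := by
        have : (R.sum : ℝ) = a + 2 - n := by linarith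
        rw [this]
        nlinarith [mul_pos (mul_pos (sub_pos.2 h3) (sub_pos.2 h4)) (pow_pos hr 2)]
      exact hpair.trans_le (mul_le_mul_of_nonneg_left (one_sub_sum_le_prod hr.le R hRr.le)
        (by linarith))
    -- For `n = 2` or `n = a` the balancing gains nothing. As `P ≠ {a, 2}`, however, `R` has at
    -- least two parts, and merging them was strict.
    · refine hpair.trans_lt (mul_lt_mul_of_pos_left ?_ (by linarith))
      rcases Multiset.empty_or_exists_mem R with rfl | ⟨b, hb⟩
      · simp at hsum
        omega
      obtain ⟨R, rfl⟩ := Multiset.exists_cons_of_mem hb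
      have hb0 := hpos b (by simp)
      rw [Multiset.sum_cons] at hsum hRr ⊢
      rcases Multiset.empty_or_exists_mem R with rfl | ⟨d, hd⟩
      · exfalso
        simp only [Multiset.sum_zero, add_zero] at hsum
        have hn' : n = 2 ∨ n = a := by omega
        rcases hn' with rfl | rfl
        · have : b = a := by omega
          subst this
          exact h2 (Multiset.cons_swap _ _ _)
        · have : b = 2 := by omega
          subst this
          exact h2 rfl
      · have hd0 := hpos d (by simp [hd])
        have := Multiset.single_le_sum (fun _ _ => Nat.zero_le _) d hd
        exact one_sub_sum_lt_prod hr hb0 (by omega) hRr.le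
  -- Only ones remain: `a` of them are merged by the Weierstrass inequality, the other two strictly.
  · have hone : P = Multiset.replicate (a + 2) 1 := by
      have h1 : ∀ n ∈ P, n = 1 := fun n hn => by
        have := hpos n hn
        by_contra hne
        exact hex ⟨n, hn, by omega⟩
      have h2 := Multiset.eq_replicate_card.2 h1
      have h3 : P.card = a + 2 := by
        rw [← hsum]
        conv_rhs => rw [h2]
        simp
      rw [h2, h3]
    rw [hone, Multiset.map_replicate, Multiset.prod_replicate, pow_add, Nat.cast_one, one_mul]
    have h3 := one_sub_sum_le_prod hr.le (Multiset.replicate a 1) (by simpa using har.le)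
    rw [Multiset.map_replicate, Multiset.prod_replicate, Multiset.sum_replicate] at h3
    simp only [smul_eq_mul, mul_one, Nat.cast_one, one_mul] at h3
    have h4 : (1 - 2 * r) < (1 - r) ^ 2 := by nlinarith [pow_pos hr 2]
    have h5 : 0 < 1 - a * r := by linarith
    have h6 : 0 < (1 - r) ^ 2 := by linarith
    calc (1 - a * r) * (1 - 2 * r) < (1 - a * r) * (1 - r) ^ 2 := mul_lt_mul_of_pos_left h4 h5
      _ ≤ (1 - r) ^ a * (1 - r) ^ 2 := mul_le_mul_of_nonneg_right h3 h6.le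

/-! ### Ordering the supertrees of diameter three -/

/-- Vertices of `c` without further edges contribute the factor one, so only the positive parts have
to be compared. -/
lemma prod_map_add_replicate (r : ℝ) (P : Multiset ℕ) (j : ℕ) :
    ((P + Multiset.replicate j 0).map fun n : ℕ => 1 - n * r).prod =
      (P.map fun n : ℕ => 1 - n * r).prod := by
  simp

namespace HasProfile

variable {V : Type u} [Fintype V] {H : Hypergraph V} {m k : ℕ} {c : Set V} {M : Multiset ℕ}

/-- Ensures that the truncated subtraction loses nothing, so any two profiles compared for the same
`k` have equal length. -/
lemma card_profile_eq (h : HasProfile H m k c M) :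
    (M + Multiset.replicate (k - M.card) 0).card = k := by
  rw [← h.profile_eq, h.isCentral.card_profile]

lemma exists_root (h : HasProfile H m k c M) (hk : 2 ≤ k) (hM : ∃ n ∈ M, 0 < n) :
    ∃ t, IsMainRoot k (M + Multiset.replicate (k - M.card) 0) t ∧ q k H = 1 + t := by
  obtain ⟨n, hn, hn0⟩ := hM
  obtain ⟨t, ht⟩ := exists_isMainRoot (k := k) (M := profile H c)
    ⟨n, by rw [h.profile_eq]; exact Multiset.mem_add.2 (Or.inl hn), hn0⟩
  exact ⟨t, h.profile_eq ▸ ht, h.isCentral.q_eq hk ht⟩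

theorem iso (h : HasProfile H m k c M) {W : Type v} [Fintype W] {G : Hypergraph W} {d : Set W}
    (h' : HasProfile G m k d M) : Iso H G :=
  h.isCentral.iso h'.isCentral (h.profile_eq.trans h'.profile_eq.symm)

theorem q_lt (h : HasProfile H m k c M) (hk : 2 ≤ k) {W : Type v} [Fintype W] {G : Hypergraph W}
    {d : Set W} {N : Multiset ℕ} (h' : HasProfile G m k d N) (hM : ∃ n ∈ M, 0 < n)
    (hN : ∃ n ∈ N, 0 < n)
    (hlt : ∀ r : ℝ, 0 < r → (∀ n ∈ N, 0 < 1 - (n : ℝ) * r) → (∀ n ∈ M, 0 < 1 - (n : ℝ) * r) ∧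
      (N.map fun n : ℕ => 1 - n * r).prod < (M.map fun n : ℕ => 1 - n * r).prod) :
    q k H < q k G := by
  obtain ⟨s, hs, hqs⟩ := h.exists_root hk hM
  obtain ⟨t, ht, hqt⟩ := h'.exists_root hk hN
  have := hs.lt_of_prod_lt ht (h.card_profile_eq.trans h'.card_profile_eq.symm)
    fun r hr hpos => by
      obtain ⟨h1, h2⟩ := hlt r hr fun n hn => hpos n (Multiset.mem_add.2 (Or.inl hn))
      refine ⟨fun n hn => ?_, ?_⟩
      · rcases Multiset.mem_add.1 hn with hn | hn
        · exact h1 n hn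
        · rw [Multiset.eq_of_mem_replicate hn]
          simp
      · rwa [prod_map_add_replicate, prod_map_add_replicate]
  rw [hqs, hqt]
  linarith

end HasProfile

/-- The zeros are split off the profile; the two ends of the diametral path provide two positive
parts. -/
theorem MemS.exists_hasProfile {V : Type u} [Fintype V] {H : Hypergraph V} {m k : ℕ} (hk : 2 ≤ k)
    (h : MemS m 3 k H) : ∃ c M, HasProfile H m k c M ∧ (∀ n ∈ M, 0 < n) ∧ M.sum + 1 = m ∧
      2 ≤ M.card := by
  classical
  obtain ⟨c, hc, x, hx, y, hy, hxy, hpx, hpy⟩ := h.exists_isCentral hk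
  have hsplit : profile H c = (profile H c).filter (0 < ·) +
      Multiset.replicate (k - ((profile H c).filter (0 < ·)).card) 0 := by
    conv_lhs => rw [← Multiset.filter_add_not (0 < ·) (profile H c)]
    congr 1
    rw [Multiset.eq_replicate]
    refine ⟨?_, fun b hb => by simpa using (Multiset.mem_filter.1 hb).2⟩
    have := congrArg Multiset.card (Multiset.filter_add_not (0 < ·) (profile H c))
    rw [Multiset.card_add, hc.card_profile] at this
    omega
  refine ⟨c, (profile H c).filter (0 < ·), ⟨h, hc, hsplit⟩, fun n hn => (Multiset.mem_filter.1 hn).2,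
    ?_, ?_⟩
  · rw [← h.edges, ← hc.sum_profile]
    conv_rhs => rw [hsplit]
    simp
  · rw [profile, Multiset.filter_map, Multiset.card_map, ← Finset.filter_val, Finset.card_val]
    refine Finset.one_lt_card.2 ⟨x, ?_, y, ?_, hxy⟩
    · simpa [hx] using pend_pos_iff.2 hpx
    · simpa [hy] using pend_pos_iff.2 hpy

lemma eq_of_sum_eq_three {M : Multiset ℕ} (hpos : ∀ n ∈ M, 0 < n) (hsum : M.sum = 3)
    (hcard : 2 ≤ M.card) : M = {2, 1} ∨ M = {1, 1, 1} := by
  have hlen : M.card ≤ 3 := by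
    rw [← hsum]
    simpa using Multiset.card_nsmul_le_sum (a := 1) hpos
  have h23 : M.card = 2 ∨ M.card = 3 := by omega
  rcases h23 with h | h
  · obtain ⟨a, b, rfl⟩ := Multiset.card_eq_two.1 h
    have ha := hpos a (by simp)
    have hb := hpos b (by simp)
    simp at hsum
    have : (a = 2 ∧ b = 1) ∨ (a = 1 ∧ b = 2) := by omega
    rcases this with ⟨rfl, rfl⟩ | ⟨rfl, rfl⟩
    · exact Or.inl rfl
    · exact Or.inl (Multiset.cons_swap _ _ _)
  · obtain ⟨a, b, d, rfl⟩ := Multiset.card_eq_three.1 h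
    have ha := hpos a (by simp)
    have hb := hpos b (by simp)
    have hd := hpos d (by simp)
    simp at hsum
    obtain ⟨rfl, rfl, rfl⟩ : a = 1 ∧ b = 1 ∧ d = 1 := by omega
    exact Or.inr rfl

end

end Supertree

end

-- The ordering for four edges and for at least five edges.

universe u

theorem theorem3p4 :
    (∀ k : ℕ, 3 ≤ k →
      Supertree.MemS 4 3 k (Supertree.S₁ 4 3 k) ∧
      Supertree.MemS 4 3 k (Supertree.S₃ 4 3 k) ∧
      (∀ (V : Type u) [Fintype V] (G : Hypergraph V), Supertree.MemS 4 3 k G →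
        Supertree.Iso G (Supertree.S₁ 4 3 k) ∨ Supertree.Iso G (Supertree.S₃ 4 3 k)) ∧
      Supertree.q k (Supertree.S₃ 4 3 k) < Supertree.q k (Supertree.S₁ 4 3 k)) ∧
    (∀ k m : ℕ, 2 ≤ k → 5 ≤ m →
      Supertree.MemS m 3 k (Supertree.S₁ m 3 k) ∧
      Supertree.MemS m 3 k (Supertree.S₄ m k) ∧
      Supertree.q k (Supertree.S₄ m k) < Supertree.q k (Supertree.S₁ m 3 k) ∧
      ∀ (V : Type u) [Fintype V] (G : Hypergraph V), Supertree.MemS m 3 k G →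
        ¬ Supertree.Iso G (Supertree.S₁ m 3 k) → ¬ Supertree.Iso G (Supertree.S₄ m k) →
        Supertree.q k G < Supertree.q k (Supertree.S₄ m k)) := by
  refine ⟨fun k hk => ?_, fun k m hk hm => ?_⟩
  · obtain ⟨c₁, h₁⟩ := Supertree.exists_hasProfile_S₁ (m := 4) (k := k) (by omega) le_rfl
    obtain ⟨c₃, h₃⟩ := Supertree.exists_hasProfile_S₃ hk
    refine ⟨h₁.memS, h₃.memS, fun V _ G hG => ?_, ?_⟩
    · obtain ⟨c, M, hM, hpos, hsum, hcard⟩ := hG.exists_hasProfile (by omega)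
      rcases Supertree.eq_of_sum_eq_three hpos (by omega) hcard with rfl | rfl
      · exact Or.inl (hM.iso h₁)
      · exact Or.inr (hM.iso h₃)
    · refine h₃.q_lt (by omega) h₁ ⟨1, by simp, one_pos⟩ ⟨1, by simp, one_pos⟩ fun r hr hpos => ?_
      have h2 := hpos 2 (by simp)
      push_cast at h2
      refine ⟨fun n hn => ?_, ?_⟩
      · have : n = 1 := by simpa using hn
        subst this
        push_cast
        linarith
      · have h3 : 0 < 1 - r := by linarith
        simp
        -- `(1 - r) ^ 3 - (1 - 2 r) (1 - r) = r ^ 2 (1 - r)`.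
        nlinarith [mul_pos (pow_pos hr 2) h3]
  -- With `m = a + 3` the extremal profiles are `{a + 1, 1}` and `{a, 2}`, and every profile has sum
  -- `a + 2`.
  · obtain ⟨a, rfl⟩ : ∃ a, m = a + 3 := ⟨m - 3, by omega⟩
    obtain ⟨c₁, h₁⟩ := Supertree.exists_hasProfile_S₁ (m := a + 3) hk (by omega)
    obtain ⟨c₄, h₄⟩ := Supertree.exists_hasProfile_S₄ (m := a + 3) hk hm
    rw [show a + 3 - 2 = a + 1 by omega] at h₁
    rw [Nat.add_sub_cancel] at h₄
    have ha : (2 : ℝ) ≤ a := by exact_mod_cast (show 2 ≤ a by omega)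
    refine ⟨h₁.memS, h₄.memS, ?_, fun V _ G hG hn₁ hn₄ => ?_⟩
    · refine h₄.q_lt hk h₁ ⟨2, by simp, two_pos⟩ ⟨1, by simp, one_pos⟩ fun r hr hpos => ?_
      have h2 := hpos (a + 1) (by simp)
      push_cast at h2
      refine ⟨fun n hn => ?_, ?_⟩
      · have : n = a ∨ n = 2 := by simpa using hn
        rcases this with rfl | rfl
        · linarith
        · push_cast
          nlinarith
      · simp
        -- `(1 - a r) (1 - 2 r) - (1 - (a + 1) r) (1 - r) = (a - 1) r ^ 2`.
        nlinarith [mul_pos (pow_pos hr 2) (show (0 : ℝ) < a - 1 by linarith)]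
    · obtain ⟨c, M, hM, hpos, hsum, hcard⟩ := hG.exists_hasProfile hk
      obtain ⟨n, hn⟩ := Multiset.card_pos_iff_exists_mem.1 (show 0 < M.card by omega)
      refine hM.q_lt hk h₄ ⟨n, hn, hpos n hn⟩ ⟨2, by simp, two_pos⟩ fun r hr hposr => ?_
      have har := hposr a (by simp)
      obtain ⟨h1, h2⟩ := Supertree.prod_lt_prod_of_ne (a := a) (by omega) hr (by linarith) hpos
        (by omega) (by rintro rfl; simp at hcard) (by rintro rfl; exact hn₁ (hM.iso h₁))
        (by rintro rfl; exact hn₄ (hM.iso h₄))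
      exact ⟨h1, by simpa using h2⟩
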